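/- Let $e\ge 2$, $n\ge 2$ and $1\le k\le e-1$. Let $G(e,e,n)$ be the group of $n\times n$ complex monomial matrices whose nonzero entries are $e$-th roots of unity with product $1$, let $\zeta_e=\exp(2\pi i/e)$, and let $$X=\{t_0,\dots,t_{e-1},s_3,\dots,s_n\}\subset G(e,e,n),$$ where $t_i$ is the block diagonal matrix with blocks $\begin{pmatrix}0&\zeta_e^{-i}\\ \zeta_e^{i}&0\end{pmatrix}$ and $I_{n-2}$, and $s_j$ is the permutation matrix of the transposition $(j-1,j)$. Let $\ell(w)$ be the minimal length of a word over $X$ representing $w\in G(e,e,n)$, and write $w'\preceq w$ if $w=w'w''$ for some $w''\in G(e,e,n)$ with $\ell(w)=\ell(w')+\ell(w'')$. Let $$\lambda=\mathrm{diag}\big(\zeta_e^{-(n-1)},\zeta_e,\dots,\zeta_e\big)\in G(e,e,n),\qquad D_k=[1,\lambda^k]=\{w\in G(e,e,n) : 1\preceq w\preceq\lambda^k\}.$$ Let $M([1,\lambda^k])$ be the monoid generated by symbols $\underline{w}$, $w\in D_k$, subject to the relations $\underline{w}=\underline{w'}\,\underline{w''}$ whenever $w,w',w''\in D_k$, $w=w'w''$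 and $\ell(w)=\ell(w')+\ell(w'')$, together with $\underline{1}=1$. Then $(M([1,\lambda^k]),\underline{\lambda^k})$ is a Garside monoid with simples $\underline{D_k}=\{\underline{w} : w\in D_k\}$, a copy of $D_k$. That is, writing $M=M([1,\lambda^k])$ and $\Delta=\underline{\lambda^k}$: 1. $M$ is left and right cancellative; 2. there is a map $\mu:M\to\mathbb{N}$ with $\mu(fg)\ge\mu(f)+\mu(g)$ for all $f,g\in M$ and $\mu(g)\ne 0$ for $g\ne 1$; 3. any two elements of $M$ have a gcd and an lcm for left divisibility, and a gcd and an lcm for right divisibility; 4. the set of left divisors of $\Delta$ in $M$ equals the set of its right divisors, is finite, and generates $M$; 5. the map $D_k\to M$, $w\mapsto\underline{w}$, is injective, and its image is the set of divisors of $\Delta$ (the simples). Moreover, the group of fractions of $M$ exists: there are a group $\Gamma$ and an injective monoid homomorphism $\iota:M\to\Gamma$ such that every element of $\Gamma$ is of the form $\iota(f)\iota(g)^{-1}$ and also of the form $\iota(g')^{-1}\iota(f')$, with $f,g,f',g'\in M$. -/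

import Mathlib

/-! ### Garside monoids

Left divisibility `f ≼ g` is Mathlib's `f ∣ g` (in a monoid: `∃ c, g = f * c`), and right
divisibility is Mathlib's `RightDvd f g` (`∃ c, g = c * f`). -/

/-- `d` is a greatest common divisor of `f` and `g` for the divisibility relation `r`. -/
def IsGcdFor {M : Type*} (r : M → M → Prop) (f g d : M) : Prop :=
  r d f ∧ r d g ∧ ∀ c, r c f → r c g → r c d

/-- `m` is a least common multiple of `f` and `g` for the divisibility relation `r`. -/
def IsLcmFor {M : Type*} (r : M → M → Prop) (f g m : M) : Prop :=
  r f m ∧ r g m ∧ ∀ c, r f c → r g c → r m c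

/-- `(M, Δ)` is a Garside monoid. -/
structure IsGarsideMonoid (M : Type*) [Monoid M] (Δ : M) : Prop where
  left_cancel : ∀ f g h : M, f * g = f * h → g = h
  right_cancel : ∀ f g h : M, g * f = h * f → g = h
  exists_weight : ∃ wt : M → ℕ,
    (∀ f g, wt f + wt g ≤ wt (f * g)) ∧ ∀ g, g ≠ 1 → wt g ≠ 0
  exists_gcd : ∀ f g : M, ∃ d, IsGcdFor (fun a b => a ∣ b) f g d
  exists_lcm : ∀ f g : M, ∃ m, IsLcmFor (fun a b => a ∣ b) f g m
  exists_right_gcd : ∀ f g : M, ∃ d, IsGcdFor RightDvd f g d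
  exists_right_lcm : ∀ f g : M, ∃ m, IsLcmFor RightDvd f g m
  divisors_eq : {f : M | f ∣ Δ} = {f : M | RightDvd f Δ}
  divisors_generate : Submonoid.closure {f : M | f ∣ Δ} = ⊤
  divisors_finite : {f : M | f ∣ Δ}.Finite

/-- The simples of `(M, Δ)`: the divisors of `Δ`. -/
def garsideSimples {M : Type*} [Monoid M] (Δ : M) : Set M := {f | f ∣ Δ}

/-- `ι : M → Γ` exhibits the group `Γ` as a group of fractions of `M`: it is an embedding, and
every element of `Γ` is both a right fraction and a left fraction of elements of `M`. -/
structure IsGroupOfFractions {M Γ : Type*} [Monoid M] [Group Γ] (ι : M →* Γ) : Prop where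
  injective : Function.Injective ι
  right_fraction : ∀ x : Γ, ∃ f g : M, x = ι f * (ι g)⁻¹
  left_fraction : ∀ x : Γ, ∃ f g : M, x = (ι g)⁻¹ * ι f

/-! ### Intervals in a group and interval monoids -/

section Interval

variable {G : Type*} [Group G]

/-- The length of `g` over `S`: the minimal length of a word over `S` representing `g`. -/
noncomputable def wordLength (S : Set G) (g : G) : ℕ :=
  sInf {r : ℕ | ∃ l : List G, (∀ x ∈ l, x ∈ S) ∧ l.prod = g ∧ l.length = r}

/-- `g ≼ f`: `g` is a divisor of `f` with respect to the length over `S`. -/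
def LengthDvd (S : Set G) (g f : G) : Prop :=
  ∃ h : G, f = g * h ∧ wordLength S f = wordLength S g + wordLength S h

/-- The interval `[1, w]`. -/
def lengthInterval (S : Set G) (w : G) : Set G :=
  {f | LengthDvd S 1 f ∧ LengthDvd S f w}

theorem wordLength_one (S : Set G) : wordLength S 1 = 0 :=
  Nat.sInf_eq_zero.2 (Or.inl ⟨[], by simp, by simp, by simp⟩)

theorem self_mem_lengthInterval (S : Set G) (w : G) : w ∈ lengthInterval S w :=
  ⟨⟨w, by simp, by simp [wordLength_one]⟩, ⟨1, by simp, by simp [wordLength_one]⟩⟩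

/-- The defining relations of the interval monoid. The copy of `1` is identified with the empty
word, so that `1` is the unit of the monoid. -/
inductive IntervalRel (S : Set G) (w : G) :
    FreeMonoid (lengthInterval S w) → FreeMonoid (lengthInterval S w) → Prop
  | mul (f g h : lengthInterval S w) (hmul : (f : G) * (g : G) = h)
      (hlen : wordLength S (f : G) + wordLength S (g : G) = wordLength S (h : G)) :
      IntervalRel S w (FreeMonoid.of f * FreeMonoid.of g) (FreeMonoid.of h)
  | one (u : lengthInterval S w) (hu : (u : G) = 1) :
      IntervalRel S w (FreeMonoid.of u) 1

/-- The interval monoid `M([1, w])`. -/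
abbrev IntervalMonoid (S : Set G) (w : G) : Type _ := PresentedMonoid (IntervalRel S w)

/-- The canonical map `f ↦ f̲` from the interval `[1, w]` to `M([1, w])`. -/
def intervalCopy (S : Set G) (w : G) (f : lengthInterval S w) : IntervalMonoid S w :=
  PresentedMonoid.of (IntervalRel S w) f

/-- The element `w̲` of `M([1, w])`. -/
def intervalTop (S : Set G) (w : G) : IntervalMonoid S w :=
  intervalCopy S w ⟨w, self_mem_lengthInterval S w⟩

end Interval

/-! ### The complex reflection group `G(e,e,n)` -/

/-- `A` is the monomial matrix whose unique nonzero entry in row `i` is `a i`, in column `σ i`. -/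
def IsMonomialWith {n : ℕ} (A : Matrix (Fin n) (Fin n) ℂ) (σ : Equiv.Perm (Fin n))
    (a : Fin n → ℂ) : Prop :=
  ∀ i j, A i j = if σ i = j then a i else 0

/-- `A` is a monomial matrix whose nonzero entries are `e`-th roots of unity with product `1`. -/
def IsGeen (e : ℕ) {n : ℕ} (A : Matrix (Fin n) (Fin n) ℂ) : Prop :=
  ∃ (σ : Equiv.Perm (Fin n)) (a : Fin n → ℂ),
    IsMonomialWith A σ a ∧ (∀ i, a i ^ e = 1) ∧ ∏ i, a i = 1

theorem IsMonomialWith.mul {n : ℕ} {A B : Matrix (Fin n) (Fin n) ℂ} {σ τ : Equiv.Perm (Fin n)}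
    {a b : Fin n → ℂ} (hA : IsMonomialWith A σ a) (hB : IsMonomialWith B τ b) :
    IsMonomialWith (A * B) (τ * σ) (fun i => a i * b (σ i)) := by
  intro i j
  simp [Matrix.mul_apply, hA i, hB (σ i) j]
  rfl

theorem IsGeen.one (e n : ℕ) : IsGeen e (1 : Matrix (Fin n) (Fin n) ℂ) :=
  ⟨1, fun _ => 1, fun i j => by simp [Matrix.one_apply]; rfl, by simp, by simp⟩

theorem IsGeen.mul {e n : ℕ} {A B : Matrix (Fin n) (Fin n) ℂ} (hA : IsGeen e A)
    (hB : IsGeen e B) : IsGeen e (A * B) := by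
  obtain ⟨σ, a, hσ, ha, ha1⟩ := hA
  obtain ⟨τ, b, hτ, hb, hb1⟩ := hB
  refine ⟨τ * σ, fun i => a i * b (σ i), hσ.mul hτ, fun i => by simp [mul_pow, ha, hb], ?_⟩
  rw [Finset.prod_mul_distrib, ha1, Equiv.prod_comp σ b, hb1, one_mul]

theorem IsGeen.inv {e n : ℕ} {g : GL (Fin n) ℂ} (hg : IsGeen e (g : Matrix (Fin n) (Fin n) ℂ)) :
    IsGeen e ((g⁻¹ : GL (Fin n) ℂ) : Matrix (Fin n) (Fin n) ℂ) := by
  obtain ⟨σ, a, hσ, ha, ha1⟩ := hg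
  have hne : ∀ i, a i ≠ 0 := fun i h0 => by
    have h := Finset.prod_eq_zero (Finset.mem_univ i) h0
    rw [ha1] at h
    exact one_ne_zero h
  set B : Matrix (Fin n) (Fin n) ℂ :=
    Matrix.of fun i j => if σ⁻¹ i = j then (a (σ⁻¹ i))⁻¹ else 0 with hBdef
  have hB : IsMonomialWith B σ⁻¹ (fun i => (a (σ⁻¹ i))⁻¹) := fun i j => by simp [hBdef]
  have hmul : (g : Matrix (Fin n) (Fin n) ℂ) * B = 1 := by
    ext i j
    rw [hσ.mul hB i j]
    simp [Matrix.one_apply, hne]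
  have hgB : ((g⁻¹ : GL (Fin n) ℂ) : Matrix (Fin n) (Fin n) ℂ) = B := by
    calc ((g⁻¹ : GL (Fin n) ℂ) : Matrix (Fin n) (Fin n) ℂ)
        = (g⁻¹ : GL (Fin n) ℂ) * ((g : Matrix (Fin n) (Fin n) ℂ) * B) := by rw [hmul, mul_one]
      _ = B := by rw [← mul_assoc, ← Units.val_mul, inv_mul_cancel, Units.val_one, one_mul]
  rw [hgB]
  refine ⟨σ⁻¹, _, hB, fun i => by simp [ha], ?_⟩
  rw [Equiv.prod_comp σ⁻¹ (fun i => (a i)⁻¹), Finset.prod_inv_distrib, ha1, inv_one]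

/-- The group `G(e,e,n)` of `n × n` monomial matrices whose nonzero entries are `e`-th roots of
unity with product `1`. -/
def Geen (e n : ℕ) : Subgroup (GL (Fin n) ℂ) where
  carrier := {g | IsGeen e (g : Matrix (Fin n) (Fin n) ℂ)}
  mul_mem' hg hh := by simpa using IsGeen.mul hg hh
  one_mem' := by simpa using IsGeen.one e n
  inv_mem' hg := IsGeen.inv hg

/-- `ζ_e = exp(2πi/e)`. -/
noncomputable def zetaRoot (e : ℕ) : ℂ := Complex.exp (2 * Real.pi * Complex.I / e)

theorem zetaRoot_pow (e : ℕ) : zetaRoot e ^ e = 1 := by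
  rcases Nat.eq_zero_or_pos e with rfl | h
  · simp
  · exact (Complex.isPrimitiveRoot_exp e h.ne').pow_eq_one

theorem zetaRoot_ne_zero (e : ℕ) : zetaRoot e ≠ 0 := Complex.exp_ne_zero _

/-- The matrix `t_i`: the block with rows `(0, ζ_e⁻ⁱ)`, `(ζ_eⁱ, 0)` on the first two coordinates,
the identity on the others (coordinates are numbered from `0` here). -/
noncomputable def tMatrix (e n i : ℕ) : Matrix (Fin n) (Fin n) ℂ :=
  Matrix.of fun r c =>
    if r.val = 0 ∧ c.val = 1 then (zetaRoot e)⁻¹ ^ i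
    else if r.val = 1 ∧ c.val = 0 then zetaRoot e ^ i
    else if r = c ∧ 2 ≤ r.val then 1 else 0

/-- The matrix `s_j`, `3 ≤ j ≤ n`: the transposition of the `(j-1)`-st and `j`-th coordinates,
which are `j - 2` and `j - 1` when numbered from `0`. -/
def sMatrix (n j : ℕ) : Matrix (Fin n) (Fin n) ℂ :=
  Matrix.of fun r c =>
    if r.val + 2 = j ∧ c.val + 1 = j then 1
    else if r.val + 1 = j ∧ c.val + 2 = j then 1
    else if r = c ∧ r.val + 2 ≠ j ∧ r.val + 1 ≠ j then 1 else 0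

/-- The Corran–Picantin generators `X = {t_0, …, t_{e-1}, s_3, …, s_n}` of `G(e,e,n)`. -/
def corranPicantinGens (e n : ℕ) : Set (Geen e n) :=
  {g | (∃ i, i < e ∧ ((g : GL (Fin n) ℂ) : Matrix (Fin n) (Fin n) ℂ) = tMatrix e n i) ∨
    ∃ j, 3 ≤ j ∧ j ≤ n ∧ ((g : GL (Fin n) ℂ) : Matrix (Fin n) (Fin n) ℂ) = sMatrix n j}

/-- The diagonal entries `(ζ_e⁻¹)ⁿ⁻¹, ζ_e, …, ζ_e` of `λ`. -/
noncomputable def lamEntry (e n : ℕ) (i : Fin n) : ℂ :=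
  if i.val = 0 then (zetaRoot e)⁻¹ ^ (n - 1) else zetaRoot e

theorem prod_lamEntry (e n : ℕ) : ∏ i, lamEntry e n i = 1 := by
  cases n with
  | zero => simp
  | succ m =>
    rw [Fin.prod_univ_succ]
    simp [lamEntry, zetaRoot_ne_zero e]

theorem lamEntry_pow (e n : ℕ) (i : Fin n) : lamEntry e n i ^ e = 1 := by
  unfold lamEntry
  split_ifs
  · rw [← pow_mul, mul_comm, pow_mul, inv_pow, zetaRoot_pow, inv_one, one_pow]
  · exact zetaRoot_pow e

/-- The element `λ = diag((ζ_e⁻¹)ⁿ⁻¹, ζ_e, …, ζ_e)` of `G(e,e,n)`. -/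
noncomputable def lam (e n : ℕ) : Geen e n :=
  ⟨Matrix.GeneralLinearGroup.mkOfDetNeZero (Matrix.diagonal (lamEntry e n))
      (by rw [Matrix.det_diagonal, prod_lamEntry]; exact one_ne_zero),
    ⟨1, lamEntry e n, fun i j => by
        simp [Matrix.GeneralLinearGroup.mkOfDetNeZero, Matrix.diagonal_apply]; rfl,
      lamEntry_pow e n, prod_lamEntry e n⟩⟩

/-! The length over `X` is explicit (`wordLength_eq_geenLength`): each pair of rows `j < i`
contributes `1` if it is inverted by the permutation, and otherwise `0` or `2` according to whether
the entry of row `i` is `1` or not. A generator swaps two consecutive rows up to a scalar. It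
changes only the contribution of that pair, by exactly one, so left divisibility by a generator is a
descent condition on two rows.

In `λ ^ k` every pair contributes `2`, so every generator divides it. Comparing contributions pair
by pair, an element of `[1, λ ^ k]` has entry `1` or `ζ_e ^ k` in the upper-index row of any
non-inverted pair (`geenVal_of_mem_interval`). This rigidity makes two distinct `t_i` have a join:
an element below `λ ^ k` that both divide has entry `ζ_e ^ k` in its second row, which determines
the next descent. The other pairs of generators have the usual commutation and braid joins. Joins of
generators give joins of all pairs (`exists_join_of_atoms`). Conjugation by `λ ^ k` preserves
length, so right factors of elements of the interval stay in it (`quotient_mem_lam_interval`).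

The rest is formal. In the monoid of an interval with these properties, two factorizations of an
element with simple first factors have a common refinement (`headRel_of_mul_eq`), whence left
cancellation and lcms; gcds follow since weights are bounded. Comparing weight and length identifies
the divisors of the top. The right-handed statements come from transposition, an anti-automorphism
preserving `X` and fixing the diagonal matrix `λ ^ k` (inversion would not fix it in general). Ore
localization yields the group of fractions. -/

/-! ### Length divisibility -/

section LengthDivisibility

variable {G : Type*} [Group G] {S : Set G}

theorem lengthDvd_iff {g f : G} :
    LengthDvd S g f ↔ wordLength S f = wordLength S g + wordLength S (g⁻¹ * f) := by
  constructor
  · rintro ⟨h, rfl, hl⟩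
    simpa using hl
  · intro h
    exact ⟨g⁻¹ * f, by simp, h⟩

theorem lengthDvd_refl (g : G) : LengthDvd S g g := ⟨1, by simp, by simp [wordLength_one]⟩

theorem one_lengthDvd (g : G) : LengthDvd S 1 g := ⟨g, by simp, by simp [wordLength_one]⟩

theorem mem_lengthInterval {w g : G} : g ∈ lengthInterval S w ↔ LengthDvd S g w :=
  ⟨fun h => h.2, fun h => ⟨one_lengthDvd g, h⟩⟩

theorem one_mem_lengthInterval (w : G) : (1 : G) ∈ lengthInterval S w :=
  mem_lengthInterval.2 (one_lengthDvd w)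

/-- Subadditivity is a hypothesis because `wordLength` takes the default value `0` on elements that
`S` does not generate. -/
theorem LengthDvd.trans (hS : ∀ g h : G, wordLength S (g * h) ≤ wordLength S g + wordLength S h)
    {f g h : G} (hfg : LengthDvd S f g) (hgh : LengthDvd S g h) : LengthDvd S f h := by
  rw [lengthDvd_iff] at *
  have h1 := hS (f⁻¹ * g) (g⁻¹ * h)
  have h2 := hS f (f⁻¹ * h)
  simp only [mul_assoc, mul_inv_cancel_left] at h1 h2
  omega

theorem LengthDvd.quotient
    (hS : ∀ g h : G, wordLength S (g * h) ≤ wordLength S g + wordLength S h)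
    {f g h : G} (hfg : LengthDvd S f g) (hgh : LengthDvd S g h) :
    LengthDvd S (f⁻¹ * g) (f⁻¹ * h) := by
  have hfh := hfg.trans hS hgh
  rw [lengthDvd_iff] at *
  have : (f⁻¹ * g)⁻¹ * (f⁻¹ * h) = g⁻¹ * h := by group
  rw [this]
  omega

theorem LengthDvd.of_quotient {f g h : G} (hfg : LengthDvd S f g) (hfh : LengthDvd S f h)
    (hq : LengthDvd S (f⁻¹ * g) (f⁻¹ * h)) : LengthDvd S g h := by
  rw [lengthDvd_iff] at *
  have : (f⁻¹ * g)⁻¹ * (f⁻¹ * h) = g⁻¹ * h := by group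
  rw [this] at hq
  omega

theorem LengthDvd.mul_of_quotient
    (hS : ∀ g h : G, wordLength S (g * h) ≤ wordLength S g + wordLength S h)
    {f q h : G} (hfh : LengthDvd S f h) (hq : LengthDvd S q (f⁻¹ * h)) :
    LengthDvd S f (f * q) ∧ LengthDvd S (f * q) h := by
  have hfq : LengthDvd S f (f * q) := by
    rw [lengthDvd_iff] at *
    have h1 := hS f q
    have h2 := hS (f * q) (q⁻¹ * (f⁻¹ * h))
    have e1 : f * q * (q⁻¹ * (f⁻¹ * h)) = h := by group
    rw [e1] at h2
    rw [inv_mul_cancel_left]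
    omega
  exact ⟨hfq, hfq.of_quotient hfh (by rwa [inv_mul_cancel_left])⟩

end LengthDivisibility

/-! ### Intervals with joins and their monoids -/

/-- The interval `[1, w]` contains the right factors of its elements, and any two of its elements
have a least upper bound for left divisibility. -/
structure IsJoinInterval {G : Type*} [Group G] (S : Set G) (w : G) : Prop where
  wordLength_mul_le : ∀ g h : G, wordLength S (g * h) ≤ wordLength S g + wordLength S h
  eq_one_of_wordLength : ∀ g : G, wordLength S g = 0 → g = 1
  quotient_mem : ∀ u v : G, LengthDvd S u v → v ∈ lengthInterval S w →
    u⁻¹ * v ∈ lengthInterval S w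
  exists_join : ∀ u ∈ lengthInterval S w, ∀ v ∈ lengthInterval S w, ∃ j ∈ lengthInterval S w,
    LengthDvd S u j ∧ LengthDvd S v j ∧
      ∀ x ∈ lengthInterval S w, LengthDvd S u x → LengthDvd S v x → LengthDvd S j x

section Monoid

variable {G : Type*} [Group G] {S : Set G} {w : G}

/-- The canonical projection of the interval monoid to the group. -/
def intervalProj (S : Set G) (w : G) : IntervalMonoid S w →* G :=
  PresentedMonoid.lift (rels := IntervalRel S w) (fun f : lengthInterval S w => (f : G)) (by
    rintro _ _ (⟨f, g, h, hmul, -⟩ | ⟨u, hu⟩)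
    · simpa using hmul
    · simpa using hu)

/-- The length homomorphism on the interval monoid. -/
noncomputable def intervalLength (S : Set G) (w : G) :
    IntervalMonoid S w →* Multiplicative ℕ :=
  PresentedMonoid.lift (rels := IntervalRel S w)
    (fun f : lengthInterval S w => Multiplicative.ofAdd (wordLength S (f : G))) (by
    rintro _ _ (⟨f, g, h, -, hlen⟩ | ⟨u, hu⟩)
    · simp [← ofAdd_add, hlen]
    · simp [hu, wordLength_one])

/-- The total length of the letters of a word representing an element of the interval monoid. -/
noncomputable def intervalWeight (m : IntervalMonoid S w) : ℕ :=
  Multiplicative.toAdd (intervalLength S w m)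

theorem intervalWeight_mul (m m' : IntervalMonoid S w) :
    intervalWeight (m * m') = intervalWeight m + intervalWeight m' := by
  simp [intervalWeight]

theorem intervalWeight_one : intervalWeight (1 : IntervalMonoid S w) = 0 := by
  simp [intervalWeight]

open Classical in
/-- The copy of `g` in the interval monoid if `g` lies in the interval, and `1` otherwise. -/
noncomputable def copyOrOne (S : Set G) (w g : G) : IntervalMonoid S w :=
  if h : g ∈ lengthInterval S w then intervalCopy S w ⟨g, h⟩ else 1

theorem copyOrOne_of_mem {g : G} (h : g ∈ lengthInterval S w) :
    copyOrOne S w g = intervalCopy S w ⟨g, h⟩ := dif_pos h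

theorem copyOrOne_coe (g : lengthInterval S w) : copyOrOne S w g = intervalCopy S w g :=
  copyOrOne_of_mem g.2

theorem copyOrOne_one : copyOrOne S w 1 = 1 := by
  rw [copyOrOne_of_mem (one_mem_lengthInterval w)]
  exact PresentedMonoid.mk_eq_mk_of_rel (IntervalRel.one _ rfl)

theorem intervalWeight_copyOrOne {g : G} (h : g ∈ lengthInterval S w) :
    intervalWeight (copyOrOne S w g) = wordLength S g := by
  rw [copyOrOne_of_mem h]
  rfl

theorem intervalProj_copyOrOne {g : G} (h : g ∈ lengthInterval S w) :
    intervalProj S w (copyOrOne S w g) = g := by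
  rw [copyOrOne_of_mem h]
  rfl

theorem copyOrOne_mul {u v : G} (hu : u ∈ lengthInterval S w) (hv : v ∈ lengthInterval S w)
    (huv : u * v ∈ lengthInterval S w)
    (hl : wordLength S (u * v) = wordLength S u + wordLength S v) :
    copyOrOne S w u * copyOrOne S w v = copyOrOne S w (u * v) := by
  rw [copyOrOne_of_mem hu, copyOrOne_of_mem hv, copyOrOne_of_mem huv]
  exact PresentedMonoid.mk_eq_mk_of_rel (IntervalRel.mul _ _ _ rfl hl.symm)

theorem intervalCopy_injective (S : Set G) (w : G) :
    Function.Injective (intervalCopy S w) := by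
  intro f g h
  have := congrArg (intervalProj S w) h
  exact Subtype.ext this

/-- Every element of the interval monoid is reached from `1` by multiplying by simples. -/
theorem interval_induction {P : IntervalMonoid S w → Prop} (one : P 1)
    (mul : ∀ s ∈ lengthInterval S w, ∀ m, P m → P (copyOrOne S w s * m)) (m) : P m := by
  obtain ⟨U, rfl⟩ := PresentedMonoid.surjective_mk m
  induction U using FreeMonoid.inductionOn' with
  | one => simpa using one
  | of_mul s U ih =>
    rw [map_mul]
    have := mul s s.2 _ ih
    rwa [copyOrOne_coe] at this

/-! ### Common refinement of two factorizations. -/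

open Classical in
/-- The first nontrivial letter of a word, and the class of what follows it. -/
noncomputable def headTail : List (lengthInterval S w) → G × IntervalMonoid S w
  | [] => (1, 1)
  | s :: l => if (s : G) = 1 then headTail l
      else ((s : G), PresentedMonoid.mk (IntervalRel S w) (FreeMonoid.ofList l))

/-- Two factorizations `p.1 * p.2` and `q.1 * q.2` have a common refinement through an upper bound
of `p.1` and `q.1` in the interval. -/
def HeadRel (p q : G × IntervalMonoid S w) : Prop :=
  ∃ j ∈ lengthInterval S w, LengthDvd S p.1 j ∧ LengthDvd S q.1 j ∧
    ∃ c, p.2 = copyOrOne S w (p.1⁻¹ * j) * c ∧ q.2 = copyOrOne S w (q.1⁻¹ * j) * c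

theorem HeadRel.symm {p q : G × IntervalMonoid S w} (h : HeadRel p q) : HeadRel q p := by
  obtain ⟨j, hj, h1, h2, c, h3, h4⟩ := h
  exact ⟨j, hj, h2, h1, c, h4, h3⟩

theorem HeadRel.refl {p : G × IntervalMonoid S w} (h : p.1 ∈ lengthInterval S w) :
    HeadRel p p :=
  ⟨p.1, h, lengthDvd_refl _, lengthDvd_refl _, p.2, by simp [copyOrOne_one],
    by simp [copyOrOne_one]⟩

theorem HeadRel.mul_right {s t : G} {a b : IntervalMonoid S w} (h : HeadRel (s, a) (t, b))
    (m : IntervalMonoid S w) : HeadRel (s, a * m) (t, b * m) := by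
  obtain ⟨j, hj, h1, h2, c, h3, h4⟩ := h
  refine ⟨j, hj, h1, h2, c * m, ?_, ?_⟩
  · simp only at h3 ⊢
    rw [h3, mul_assoc]
  · simp only at h4 ⊢
    rw [h4, mul_assoc]

theorem headTail_fst_mem (l : List (lengthInterval S w)) :
    (headTail l).1 ∈ lengthInterval S w := by
  induction l with
  | nil => exact one_mem_lengthInterval w
  | cons s l ih =>
    rw [headTail]
    split_ifs
    exacts [ih, s.2]

theorem mk_ofList_cons (s : lengthInterval S w) (l : List (lengthInterval S w)) :
    PresentedMonoid.mk (IntervalRel S w) (FreeMonoid.ofList (s :: l)) =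
      copyOrOne S w s * PresentedMonoid.mk (IntervalRel S w) (FreeMonoid.ofList l) := by
  rw [FreeMonoid.ofList_cons, map_mul, copyOrOne_coe]
  rfl

theorem headTail_mul (l : List (lengthInterval S w)) :
    copyOrOne S w (headTail l).1 * (headTail l).2 =
      PresentedMonoid.mk (IntervalRel S w) (FreeMonoid.ofList l) := by
  induction l with
  | nil => simp [headTail, copyOrOne_one]
  | cons s l ih =>
    rw [mk_ofList_cons, headTail]
    split_ifs with h
    · rw [ih, h, copyOrOne_one, one_mul]
    · rfl

theorem headTail_eq_one {l : List (lengthInterval S w)} (h : (headTail l).1 = 1) :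
    headTail l = (1, 1) := by
  induction l with
  | nil => rfl
  | cons s l ih =>
    rw [headTail] at h ⊢
    split_ifs at h ⊢ with hs
    · exact ih h
    · exact absurd h hs

theorem headTail_append_of_eq_one {l : List (lengthInterval S w)} (h : (headTail l).1 = 1)
    (l' : List (lengthInterval S w)) : headTail (l ++ l') = headTail l' := by
  induction l with
  | nil => rfl
  | cons s l ih =>
    rw [headTail] at h
    rw [List.cons_append, headTail]
    split_ifs at h ⊢ with hs
    · exact ih h
    · exact absurd h hs

theorem headTail_append_of_ne_one {l : List (lengthInterval S w)} (h : (headTail l).1 ≠ 1)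
    (l' : List (lengthInterval S w)) :
    headTail (l ++ l') = ((headTail l).1, (headTail l).2 *
      PresentedMonoid.mk (IntervalRel S w) (FreeMonoid.ofList l')) := by
  induction l with
  | nil => exact absurd rfl h
  | cons s l ih =>
    rw [headTail] at h ⊢
    rw [List.cons_append, headTail]
    split_ifs at h ⊢ with hs
    · exact ih h
    · simp [FreeMonoid.ofList_append]

namespace IsJoinInterval

theorem mem_of_dvd (H : IsJoinInterval S w)
    {u v : G} (h : LengthDvd S u v) (hv : v ∈ lengthInterval S w) :
    u ∈ lengthInterval S w :=
  mem_lengthInterval.2 (h.trans H.wordLength_mul_le (mem_lengthInterval.1 hv))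

theorem copy_mul_quotient (H : IsJoinInterval S w)
    {u v : G} (h : LengthDvd S u v) (hv : v ∈ lengthInterval S w) :
    copyOrOne S w u * copyOrOne S w (u⁻¹ * v) = copyOrOne S w v := by
  rw [copyOrOne_mul (H.mem_of_dvd h hv) (H.quotient_mem _ _ h hv) (by simpa using hv)
    (by simpa using lengthDvd_iff.1 h), mul_inv_cancel_left]

theorem copy_quotient_mul (H : IsJoinInterval S w)
    {u v x : G} (h : LengthDvd S u v) (h' : LengthDvd S v x)
    (hx : x ∈ lengthInterval S w) :
    copyOrOne S w (u⁻¹ * v) * copyOrOne S w (v⁻¹ * x) = copyOrOne S w (u⁻¹ * x) := by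
  rw [← H.copy_mul_quotient (h.quotient H.wordLength_mul_le h')
    (H.quotient_mem _ _ (h.trans H.wordLength_mul_le h') hx)]
  congr 2
  group

theorem intervalWeight_ne_zero (H : IsJoinInterval S w)
    {m : IntervalMonoid S w} (hm : m ≠ 1) : intervalWeight m ≠ 0 := by
  revert hm
  induction m using interval_induction with
  | one => simp
  | mul s hs m ih =>
    intro hm h0
    rw [intervalWeight_mul, intervalWeight_copyOrOne hs] at h0
    have hs1 := H.eq_one_of_wordLength s (by omega)
    rw [hs1, copyOrOne_one, one_mul] at hm
    exact ih hm (by omega)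

/-- The two refinements give two factorizations of the middle tail `q.2`, which `ih` refines through
some `r`. Although `q.1 * r` may leave the interval, `r` can be replaced by the join `l` of `q.1⁻¹ *
i` and `q.1⁻¹ * j`, and `q.1 * l` stays inside. -/
theorem headRel_trans (H : IsJoinInterval S w)
    {p q x : G × IntervalMonoid S w} (hpq : HeadRel p q) (hqx : HeadRel q x)
    (ih : ∀ s ∈ lengthInterval S w, ∀ t ∈ lengthInterval S w, ∀ a b,
      copyOrOne S w s * a = q.2 → copyOrOne S w t * b = q.2 → HeadRel (s, a) (t, b)) :
    HeadRel p x := by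
  obtain ⟨i, hi, hpi, hqi, c, hp, hq⟩ := hpq
  obtain ⟨j, hj, hqj, hxj, d, hq', hx⟩ := hqx
  obtain ⟨r, hr, hir, hjr, b, hc, hd⟩ := ih _ (H.quotient_mem _ _ hqi hi) _
    (H.quotient_mem _ _ hqj hj) c d hq.symm hq'.symm
  obtain ⟨l, hl, hil, hjl, hl'⟩ := H.exists_join _ (H.quotient_mem _ _ hqi hi) _
    (H.quotient_mem _ _ hqj hj)
  obtain ⟨k, hk, hik, hjk, -⟩ := H.exists_join i hi j hj
  have hT := H.wordLength_mul_le
  have hqk := hqi.trans hT hik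
  -- An upper bound `k` of `i` and `j` in the interval is what keeps `q.1 * l` below the top.
  have hlk : LengthDvd S l (q.1⁻¹ * k) := hl' _ (H.quotient_mem _ _ hqk hk)
    (hqi.quotient hT hik) (hqj.quotient hT hjk)
  have hlr := hl' r hr hir hjr
  obtain ⟨hql, hqlk⟩ := hqk.mul_of_quotient hT hlk
  have hqlmem := H.mem_of_dvd hqlk hk
  have hi' : LengthDvd S i (q.1 * l) := hqi.of_quotient hql (by rwa [inv_mul_cancel_left])
  have hj' : LengthDvd S j (q.1 * l) := hqj.of_quotient hql (by rwa [inv_mul_cancel_left])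
  have e1 : (q.1⁻¹ * i)⁻¹ * l = i⁻¹ * (q.1 * l) := by group
  have e2 : (q.1⁻¹ * j)⁻¹ * l = j⁻¹ * (q.1 * l) := by group
  refine ⟨q.1 * l, hqlmem, hpi.trans hT hi', hxj.trans hT hj', copyOrOne S w (l⁻¹ * r) * b, ?_, ?_⟩
  · rw [hp, ← H.copy_quotient_mul hpi hi' hqlmem, mul_assoc, ← e1,
      ← mul_assoc _ (copyOrOne S w (l⁻¹ * r)), H.copy_quotient_mul hil hlr hr]
    exact congrArg _ hc
  · rw [hx, ← H.copy_quotient_mul hxj hj' hqlmem, mul_assoc, ← e2,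
      ← mul_assoc _ (copyOrOne S w (l⁻¹ * r)), H.copy_quotient_mul hjl hlr hr]
    exact congrArg _ hd

theorem headTail_eq_of_mk_eq_one (H : IsJoinInterval S w) {l : List (lengthInterval S w)}
    (h : PresentedMonoid.mk (IntervalRel S w) (FreeMonoid.ofList l) = 1) :
    headTail l = (1, 1) := by
  apply headTail_eq_one
  apply H.eq_one_of_wordLength
  have := congrArg intervalWeight ((headTail_mul l).trans h)
  rw [intervalWeight_mul, intervalWeight_copyOrOne (headTail_fst_mem l), intervalWeight_one] at this
  omega

/-- Induction on the derivation of the congruence. Only transitivity needs `ih`; it is applied to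
the tail of the middle word, whose weight is below `N` once a nontrivial first letter has been
removed. -/
theorem headRel_headTail (H : IsJoinInterval S w) {N : ℕ}
    (ih : ∀ s ∈ lengthInterval S w, ∀ t ∈ lengthInterval S w, ∀ a b,
      intervalWeight (copyOrOne S w s * a) < N → copyOrOne S w s * a = copyOrOne S w t * b →
      HeadRel (s, a) (t, b))
    {U V : FreeMonoid (lengthInterval S w)} (hUV : ConGen.Rel (IntervalRel S w) U V)
    (hN : intervalWeight (PresentedMonoid.mk (IntervalRel S w) U) ≤ N) :
    HeadRel (headTail U.toList) (headTail V.toList) := by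
  induction hUV with
  | of U V h =>
    obtain ⟨f, g, h, hmul, hlen⟩ | ⟨u, hu⟩ := h
    · by_cases hf : (f : G) = 1
      · have hgh : g = h := Subtype.ext (by rw [← hmul, hf, one_mul])
        subst hgh
        have : headTail (FreeMonoid.toList (FreeMonoid.of f * FreeMonoid.of g)) =
            headTail (FreeMonoid.toList (FreeMonoid.of g)) := by
          simp [headTail, hf]
        rw [this]
        exact HeadRel.refl (headTail_fst_mem _)
      · have hh : (h : G) ≠ 1 := by
          intro h1
          rw [h1, wordLength_one] at hlen
          exact hf (H.eq_one_of_wordLength _ (by omega))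
        -- The heads are `f` and `h = f * g`; their refinement goes through `h` itself, with nothing
        -- left over.
        have hfh : (f : G)⁻¹ * h = g := by rw [← hmul, inv_mul_cancel_left]
        refine ⟨h, h.2, ?_, ?_, 1, ?_, ?_⟩
        · simp only [FreeMonoid.toList_mul, FreeMonoid.toList_of, List.cons_append, headTail, hf,
            if_false]
          exact ⟨g, hmul.symm, hlen.symm⟩
        · simp only [FreeMonoid.toList_of, headTail, hh, if_false]
          exact lengthDvd_refl _
        · simp only [FreeMonoid.toList_mul, FreeMonoid.toList_of, List.cons_append, headTail, hf,
            if_false, hfh, List.nil_append]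
          rw [mk_ofList_cons]
          simp
        · simp [headTail, hh, copyOrOne_one]
    · have : headTail (FreeMonoid.toList (FreeMonoid.of u)) =
          headTail (FreeMonoid.toList 1) := by
        simp [headTail, hu]
      rw [this]
      exact HeadRel.refl (headTail_fst_mem _)
  | refl U => exact HeadRel.refl (headTail_fst_mem _)
  | symm h hi =>
    rw [← PresentedMonoid.mk_eq_mk_iff.2 h] at hN
    exact (hi hN).symm
  | @trans U V W h h' hi hi' =>
    have e := PresentedMonoid.mk_eq_mk_iff.2 h
    have e' := PresentedMonoid.mk_eq_mk_iff.2 h'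
    have h1 := hi hN
    rw [e] at hN
    have h2 := hi' hN
    by_cases hV : (headTail V.toList).1 = 1
    · have hV1 := headTail_mul V.toList
      rw [headTail_eq_one hV] at hV1
      simp only [copyOrOne_one, mul_one, FreeMonoid.ofList_toList] at hV1
      rw [H.headTail_eq_of_mk_eq_one (l := U.toList) (by simp [e, ← hV1]),
        H.headTail_eq_of_mk_eq_one (l := W.toList) (by simp [← e', ← hV1])]
      exact HeadRel.refl (one_mem_lengthInterval w)
    · refine H.headRel_trans h1 h2 fun s hs t ht a b hsa htb =>
        ih s hs t ht a b ?_ (hsa.trans htb.symm)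
      have hm := congrArg intervalWeight (headTail_mul V.toList)
      rw [intervalWeight_mul, intervalWeight_copyOrOne (headTail_fst_mem _)] at hm
      have : wordLength S (headTail V.toList).1 ≠ 0 := fun h => hV (H.eq_one_of_wordLength _ h)
      rw [FreeMonoid.ofList_toList] at hm
      rw [hsa]
      omega
  | @mul U V U' V' h h' hi hi' =>
    have e := PresentedMonoid.mk_eq_mk_iff.2 h
    have e' := PresentedMonoid.mk_eq_mk_iff.2 h'
    rw [map_mul, intervalWeight_mul] at hN
    have h1 := hi (by omega)
    have h2 := hi' (by omega)
    rw [FreeMonoid.toList_mul, FreeMonoid.toList_mul]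
    -- Whether a word has only trivial letters depends on its class alone, so the heads of the two
    -- products come either both from the first factors or both from the second.
    by_cases hU : (headTail U.toList).1 = 1
    · have hU1 := headTail_mul U.toList
      rw [headTail_eq_one hU] at hU1
      simp only [copyOrOne_one, mul_one, FreeMonoid.ofList_toList] at hU1
      have hV : headTail V.toList = (1, 1) :=
        H.headTail_eq_of_mk_eq_one (by simp [← e, ← hU1])
      rw [headTail_append_of_eq_one hU, headTail_append_of_eq_one (by rw [hV])]
      exact h2
    · have hV : (headTail V.toList).1 ≠ 1 := by
        intro hV
        have hV1 := headTail_mul V.toList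
        rw [headTail_eq_one hV] at hV1
        simp only [copyOrOne_one, mul_one, FreeMonoid.ofList_toList] at hV1
        exact hU (by rw [H.headTail_eq_of_mk_eq_one (l := U.toList) (by simp [e, ← hV1])])
      rw [headTail_append_of_ne_one hU, headTail_append_of_ne_one hV, FreeMonoid.ofList_toList,
        FreeMonoid.ofList_toList, e']
      exact HeadRel.mul_right h1 _

/-- Two factorizations of an element with simple first factors have a common refinement. -/
theorem headRel_of_mul_eq (H : IsJoinInterval S w)
    {s t : G} (hs : s ∈ lengthInterval S w) (ht : t ∈ lengthInterval S w)
    {a b : IntervalMonoid S w} (h : copyOrOne S w s * a = copyOrOne S w t * b) :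
    HeadRel (s, a) (t, b) := by
  induction hN : intervalWeight (copyOrOne S w s * a) using Nat.strong_induction_on
    generalizing s t a b with
  | _ N ih =>
  by_cases hs1 : s = 1
  · subst hs1
    rw [copyOrOne_one, one_mul] at h
    exact ⟨t, ht, one_lengthDvd _, lengthDvd_refl _, b, by simp [h], by simp [copyOrOne_one]⟩
  by_cases ht1 : t = 1
  · subst ht1
    rw [copyOrOne_one, one_mul] at h
    exact ⟨s, hs, lengthDvd_refl _, one_lengthDvd _, a, by simp [copyOrOne_one], by simp [h]⟩
  obtain ⟨U, rfl⟩ := PresentedMonoid.surjective_mk a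
  obtain ⟨V, rfl⟩ := PresentedMonoid.surjective_mk b
  have key := H.headRel_headTail (N := N)
    (fun s hs t ht a b hlt h => ih _ hlt hs ht h rfl)
    (U := FreeMonoid.of ⟨s, hs⟩ * U) (V := FreeMonoid.of ⟨t, ht⟩ * V)
    (PresentedMonoid.mk_eq_mk_iff.1 (by
      rw [copyOrOne_of_mem hs, copyOrOne_of_mem ht] at h
      rw [map_mul, map_mul]
      exact h))
    (by
      rw [copyOrOne_of_mem hs] at hN
      rw [map_mul]
      exact hN.le)
  simpa [headTail, hs1, ht1] using key

/-! ### Cancellation, lcms and gcds. -/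

theorem left_cancel (H : IsJoinInterval S w)
    (f g h : IntervalMonoid S w) (hfg : f * g = f * h) : g = h := by
  induction f using interval_induction with
  | one => simpa using hfg
  | mul s hs m ih =>
    rw [mul_assoc, mul_assoc] at hfg
    obtain ⟨j, hj, -, -, c, h1, h2⟩ := H.headRel_of_mul_eq hs hs hfg
    exact ih (h1.trans h2.symm)

/-- With `j` the join of `s` and `t`, the lcm of `s` and `t * b` is `t` times the lcm of the simple
`t⁻¹ * j` and the shorter element `b`. -/
theorem exists_lcm_copy (H : IsJoinInterval S w)
    (b : IntervalMonoid S w) {s : G} (hs : s ∈ lengthInterval S w) :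
    ∃ m, IsLcmFor (fun a b => a ∣ b) (copyOrOne S w s) b m := by
  induction b using interval_induction generalizing s with
  | one => exact ⟨_, dvd_rfl, one_dvd _, fun c h _ => h⟩
  | mul t ht b ih =>
    obtain ⟨j, hj, hsj, htj, hj'⟩ := H.exists_join s hs t ht
    obtain ⟨l, hl1, hl2, hl⟩ := ih (H.quotient_mem _ _ htj hj)
    refine ⟨copyOrOne S w t * l, ?_, mul_dvd_mul_left _ hl2, ?_⟩
    · refine dvd_trans ?_ (mul_dvd_mul_left _ hl1)
      rw [H.copy_mul_quotient htj hj, ← H.copy_mul_quotient hsj hj]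
      exact dvd_mul_right _ _
    · rintro _ ⟨z, rfl⟩ ⟨y, hy⟩
      rw [mul_assoc] at hy
      -- A common multiple factors through an upper bound `i` of `s` and `t`, hence through their
      -- join `j`.
      obtain ⟨i, hi, hsi, hti, c, -, h2⟩ := H.headRel_of_mul_eq hs ht hy
      rw [hy]
      refine mul_dvd_mul_left _ (hl _ ?_ (dvd_mul_right _ _))
      simp only at h2
      rw [h2, ← H.copy_quotient_mul htj (hj' i hi hsi hti) hi, mul_assoc]
      exact dvd_mul_right _ _

/-- If `s * g` is the lcm of `s` and `b`, then `s` times the lcm of `a` and `g` is the lcm of `s *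
a` and `b`. -/
theorem exists_lcm (H : IsJoinInterval S w)
    (a b : IntervalMonoid S w) : ∃ m, IsLcmFor (fun a b => a ∣ b) a b m := by
  induction a using interval_induction generalizing b with
  | one => exact ⟨b, one_dvd _, dvd_rfl, fun c _ h => h⟩
  | mul s hs a ih =>
    obtain ⟨_, ⟨g, rfl⟩, hb, hm⟩ := H.exists_lcm_copy b hs
    obtain ⟨l, hl1, hl2, hl⟩ := ih g
    refine ⟨copyOrOne S w s * l, mul_dvd_mul_left _ hl1, hb.trans (mul_dvd_mul_left _ hl2), ?_⟩
    rintro _ ⟨y, rfl⟩ hc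
    obtain ⟨z, hz⟩ := hm _ (by rw [mul_assoc]; exact dvd_mul_right _ _) hc
    rw [mul_assoc, mul_assoc] at hz
    rw [mul_assoc]
    exact mul_dvd_mul_left _ (hl _ (dvd_mul_right _ _) ⟨z, H.left_cancel _ _ _ hz⟩)

/-- A common divisor of maximal weight works: its lcm with any other common divisor is again a
common divisor, so it has no larger weight and equals the first one. -/
theorem exists_gcd (H : IsJoinInterval S w)
    (a b : IntervalMonoid S w) : ∃ d, IsGcdFor (fun a b => a ∣ b) a b d := by
  have hne : {r | ∃ d, d ∣ a ∧ d ∣ b ∧ intervalWeight d = r}.Nonempty :=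
    ⟨_, 1, one_dvd _, one_dvd _, rfl⟩
  have hbdd : BddAbove {r | ∃ d, d ∣ a ∧ d ∣ b ∧ intervalWeight d = r} := by
    refine ⟨intervalWeight a, ?_⟩
    rintro _ ⟨d, ⟨x, rfl⟩, -, rfl⟩
    rw [intervalWeight_mul]
    omega
  obtain ⟨d, hda, hdb, hd⟩ := Nat.sSup_mem hne hbdd
  refine ⟨d, hda, hdb, fun c hca hcb => ?_⟩
  obtain ⟨m, hcm, ⟨x, rfl⟩, hm⟩ := H.exists_lcm c d
  have hle := le_csSup hbdd ⟨d * x, hm a hca hda, hm b hcb hdb, rfl⟩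
  rw [← hd, intervalWeight_mul] at hle
  have hx : x = 1 := by
    by_contra hx
    exact H.intervalWeight_ne_zero hx (by omega)
  simpa [hx] using hcm

/-! ### The simples as divisors of the top. -/

theorem wordLength_proj_le (H : IsJoinInterval S w) (m : IntervalMonoid S w) :
    wordLength S (intervalProj S w m) ≤ intervalWeight m := by
  induction m using interval_induction with
  | one => simp [wordLength_one]
  | mul s hs m ih =>
    rw [map_mul, intervalWeight_mul, intervalWeight_copyOrOne hs, intervalProj_copyOrOne hs]
    exact (H.wordLength_mul_le _ _).trans (by omega)

/-- An element whose weight is the length of its image is the copy of that image. -/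
theorem eq_copyOrOne_of_weight (H : IsJoinInterval S w) (m : IntervalMonoid S w)
    (hm : intervalProj S w m ∈ lengthInterval S w)
    (hw : wordLength S (intervalProj S w m) = intervalWeight m) :
    m = copyOrOne S w (intervalProj S w m) := by
  induction m using interval_induction with
  | one => simp [copyOrOne_one]
  | mul s hs m ih =>
    have h1 := H.wordLength_proj_le m
    rw [map_mul, intervalProj_copyOrOne hs] at hm hw ⊢
    rw [intervalWeight_mul, intervalWeight_copyOrOne hs] at hw
    have h2 := H.wordLength_mul_le s (intervalProj S w m)
    have hl : wordLength S (s * intervalProj S w m) =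
      wordLength S s + wordLength S (intervalProj S w m) := by omega
    have hq := H.quotient_mem s _ ⟨_, rfl, hl⟩ hm
    rw [inv_mul_cancel_left] at hq
    rw [← copyOrOne_mul hs hq hm hl, ← ih hq (by omega)]

/-- If `f * g` is the top, the weights of `f` and `g` add up to the length of `w`, while the lengths
of their images are at most these weights and add up to at least that length. All are equalities, so
the image of `f` divides `w` and `f` is its copy. -/
theorem dvd_intervalTop_iff (H : IsJoinInterval S w) (f : IntervalMonoid S w) :
    f ∣ intervalTop S w ↔ f ∈ Set.range (intervalCopy S w) := by
  have htop : intervalTop S w = copyOrOne S w w :=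
    (copyOrOne_of_mem (self_mem_lengthInterval S w)).symm
  have hw := self_mem_lengthInterval S w
  constructor
  · rintro ⟨g, hg⟩
    rw [htop] at hg
    have h1 := congrArg intervalWeight hg
    have h2 := congrArg (intervalProj S w) hg
    rw [intervalWeight_mul, intervalWeight_copyOrOne hw] at h1
    rw [map_mul, intervalProj_copyOrOne hw] at h2
    have h3 := H.wordLength_mul_le (intervalProj S w f) (intervalProj S w g)
    rw [← h2] at h3
    have h4 := H.wordLength_proj_le f
    have h5 := H.wordLength_proj_le g
    have hf : intervalProj S w f ∈ lengthInterval S w :=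
      mem_lengthInterval.2 ⟨_, h2, by omega⟩
    have := H.eq_copyOrOne_of_weight f hf (by omega)
    rw [copyOrOne_of_mem hf] at this
    exact ⟨_, this.symm⟩
  · rintro ⟨f, rfl⟩
    rw [← copyOrOne_coe, htop, ← H.copy_mul_quotient (mem_lengthInterval.1 f.2) hw]
    exact dvd_mul_right _ _

end IsJoinInterval

end Monoid

/-! ### Groups of fractions -/

/-- A cancellative monoid with common multiples on both sides has a group of fractions. -/
theorem exists_isGroupOfFractions.{u} {M : Type u} [Monoid M]
    (left_cancel : ∀ f g h : M, f * g = f * h → g = h)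
    (right_cancel : ∀ f g h : M, g * f = h * f → g = h)
    (left_multiple : ∀ f g : M, ∃ x y, x * f = y * g)
    (right_multiple : ∀ f g : M, ∃ x y, f * x = g * y) :
    ∃ (Γ : Type u) (_ : Group Γ) (ι : M →* Γ), IsGroupOfFractions ι := by
  choose x y hxy using left_multiple
  let _ : OreLocalization.OreSet (⊤ : Submonoid M) :=
    { ore_right_cancel := fun r₁ r₂ s h => ⟨1, by rw [right_cancel _ _ _ h]⟩
      oreNum := fun r s => y r s
      oreDenom := fun r s => ⟨x r s, trivial⟩
      ore_eq := fun r s => hxy r s }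
  have hunit : ∀ m : M, IsUnit (OreLocalization.numeratorHom (S := (⊤ : Submonoid M)) m) :=
    fun m => OreLocalization.numerator_isUnit (S := (⊤ : Submonoid M)) ⟨m, trivial⟩
  have hdiv : ∀ (r : M) (s : (⊤ : Submonoid M)),
      OreLocalization.numeratorHom (s : M) * OreLocalization.oreDiv r s =
        OreLocalization.numeratorHom r := by
    intro r s
    rw [OreLocalization.numeratorHom_apply, OreLocalization.mul_cancel,
      OreLocalization.numeratorHom_apply]
  -- Localizing at all of `M` makes both numerator and denominator invertible.
  have hall : ∀ z : OreLocalization (⊤ : Submonoid M) M, IsUnit z := by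
    intro z
    induction z using OreLocalization.ind with
    | _ r s =>
    have h := hdiv r s
    have hu : IsUnit (OreLocalization.numeratorHom (S := (⊤ : Submonoid M)) r) := hunit r
    rw [← h, ← (hunit s).unit_spec, Units.isUnit_units_mul] at hu
    exact hu
  let _ : Group (OreLocalization (⊤ : Submonoid M) M) := groupOfIsUnit hall
  have hleft : ∀ z : OreLocalization (⊤ : Submonoid M) M, ∃ f g : M,
      z = (OreLocalization.numeratorHom g)⁻¹ * OreLocalization.numeratorHom f := by
    intro z
    induction z using OreLocalization.ind with
    | _ r s => exact ⟨r, s, eq_inv_mul_of_mul_eq (hdiv r s)⟩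
  refine ⟨OreLocalization (⊤ : Submonoid M) M, inferInstance, OreLocalization.numeratorHom,
    ⟨?_, ?_, hleft⟩⟩
  · intro a b hab
    rw [OreLocalization.numeratorHom_apply, OreLocalization.numeratorHom_apply,
      OreLocalization.oreDiv_eq_iff] at hab
    obtain ⟨u, v, h1, h2⟩ := hab
    have huv : (u : M) = v := by simpa using h2
    have h1' : (u : M) * b = v * a := h1
    rw [← huv] at h1'
    exact (left_cancel _ _ _ h1').symm
  · intro z
    obtain ⟨f, g, rfl⟩ := hleft z
    -- From `f * c = g * d`, the left fraction `g⁻¹ f` equals `d c⁻¹`.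
    obtain ⟨c, d, hcd⟩ := right_multiple f g
    refine ⟨d, c, ?_⟩
    rw [eq_mul_inv_iff_mul_eq, mul_assoc, inv_mul_eq_iff_eq_mul, ← map_mul, ← map_mul, hcd]

/-! ### The Garside structure of an interval monoid -/

namespace IsJoinInterval

variable {G : Type*} [Group G] {S : Set G} {w : G}

/-- The map `ρ` turns a left factor of `w` into a right factor, and right factors lie in the
interval by `quotient_mem`. -/
theorem antiautomorphism_mem (H : IsJoinInterval S w) {ρ : G → G}
    (hmul : ∀ g h, ρ (g * h) = ρ h * ρ g) (hlen : ∀ g, wordLength S (ρ g) = wordLength S g)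
    (hw : ρ w = w) {g : G} (hg : g ∈ lengthInterval S w) : ρ g ∈ lengthInterval S w := by
  obtain ⟨h, hh, hl⟩ := mem_lengthInterval.1 hg
  have h1 : w = ρ h * ρ g := by rw [← hmul, ← hh, hw]
  have h2 := H.quotient_mem (ρ h) w ⟨ρ g, h1, by rw [hlen, hlen, hl, add_comm]⟩
    (self_mem_lengthInterval S w)
  rwa [← eq_inv_mul_of_mul_eq h1.symm] at h2

/-- An anti-automorphism of the group preserving the length and `w` induces an anti-automorphism
of the interval monoid. -/
theorem exists_reversal (H : IsJoinInterval S w) {ρ : G → G}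
    (hmul : ∀ g h, ρ (g * h) = ρ h * ρ g) (hinv : ∀ g, ρ (ρ g) = g)
    (hlen : ∀ g, wordLength S (ρ g) = wordLength S g) (hw : ρ w = w) :
    ∃ rev : IntervalMonoid S w → IntervalMonoid S w, (∀ a b, rev (a * b) = rev b * rev a) ∧
      (∀ a, rev (rev a) = a) ∧
      ∀ g ∈ lengthInterval S w, rev (copyOrOne S w g) = copyOrOne S w (ρ g) := by
  have hmem := fun g hg => H.antiautomorphism_mem (g := g) hmul hlen hw hg
  have hone : ρ 1 = 1 := by simpa using hmul 1 1
  -- An anti-homomorphism is a homomorphism to the opposite monoid, so the presentation applies.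
  let φ : IntervalMonoid S w →* (IntervalMonoid S w)ᵐᵒᵖ :=
    PresentedMonoid.lift (rels := IntervalRel S w)
      (fun f : lengthInterval S w => MulOpposite.op (copyOrOne S w (ρ f))) (by
      rintro _ _ (⟨f, g, h, hfg, hl⟩ | ⟨u, hu⟩)
      · simp only [map_mul, FreeMonoid.lift_eval_of, ← MulOpposite.op_mul]
        rw [copyOrOne_mul (hmem _ g.2) (hmem _ f.2) (by rw [← hmul, hfg]; exact hmem _ h.2)
          (by rw [← hmul, hfg, hlen, hlen, hlen, ← hl, add_comm]), ← hmul, hfg]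
      · simp [hu, hone, copyOrOne_one])
  have hφ : ∀ g ∈ lengthInterval S w,
      (φ (copyOrOne S w g)).unop = copyOrOne S w (ρ g) := by
    intro g hg
    rw [copyOrOne_of_mem hg]
    rfl
  refine ⟨fun a => (φ a).unop, fun a b => by simp, fun a => ?_, hφ⟩
  induction a using interval_induction with
  | one => simp
  | mul s hs m ih =>
    simp only [map_mul, MulOpposite.unop_mul] at ih ⊢
    rw [ih, hφ _ hs, hφ _ (hmem _ hs), hinv]

/-- A finite interval with joins that is stable under an anti-automorphism fixing its top yields a
Garside monoid, which has a group of fractions. -/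
theorem isGarsideMonoid (H : IsJoinInterval S w) (hfin : (lengthInterval S w).Finite) {ρ : G → G}
    (hmul : ∀ g h, ρ (g * h) = ρ h * ρ g) (hinv : ∀ g, ρ (ρ g) = g)
    (hlen : ∀ g, wordLength S (ρ g) = wordLength S g) (hw : ρ w = w) :
    IsGarsideMonoid (IntervalMonoid S w) (intervalTop S w) := by
  obtain ⟨rev, rmul, rinv, rcopy⟩ := H.exists_reversal hmul hinv hlen hw
  have hdvd : ∀ a b, RightDvd a b ↔ rev a ∣ rev b := by
    intro a b
    constructor
    · rintro ⟨c, rfl⟩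
      rw [rmul]
      exact dvd_mul_right _ _
    · rintro ⟨c, hc⟩
      refine ⟨rev c, ?_⟩
      rw [← rinv b, hc, rmul, rinv]
  have hdvd' : ∀ a b, RightDvd (rev a) b ↔ a ∣ rev b := by
    intro a b
    rw [hdvd, rinv]
  have hdvd'' : ∀ a b, RightDvd a (rev b) ↔ rev a ∣ b := by
    intro a b
    rw [hdvd, rinv]
  have hset : {f | f ∣ intervalTop S w} = Set.range (intervalCopy S w) :=
    Set.ext H.dvd_intervalTop_iff
  have htop : rev (intervalTop S w) = intervalTop S w := by
    have : intervalTop S w = copyOrOne S w w :=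
      (copyOrOne_of_mem (self_mem_lengthInterval S w)).symm
    rw [this, rcopy _ (self_mem_lengthInterval S w), hw]
  have hrange : ∀ f, f ∈ Set.range (intervalCopy S w) → rev f ∈ Set.range (intervalCopy S w) := by
    rintro _ ⟨g, rfl⟩
    rw [← copyOrOne_coe, rcopy _ g.2,
      copyOrOne_of_mem (H.antiautomorphism_mem hmul hlen hw g.2)]
    exact ⟨_, rfl⟩
  refine
    { left_cancel := H.left_cancel
      right_cancel := fun f g h hfg => ?_
      exists_weight := ⟨intervalWeight, fun f g => (intervalWeight_mul f g).ge,
        fun g hg => H.intervalWeight_ne_zero hg⟩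
      exists_gcd := H.exists_gcd
      exists_lcm := H.exists_lcm
      exists_right_gcd := fun f g => ?_
      exists_right_lcm := fun f g => ?_
      divisors_eq := ?_
      divisors_generate := by
        rw [hset]
        exact PresentedMonoid.closure_range_of (IntervalRel S w)
      divisors_finite := by
        rw [hset]
        have := hfin.to_subtype
        exact Set.finite_range _ }
  · have h1 := congrArg rev hfg
    rw [rmul, rmul] at h1
    rw [← rinv g, H.left_cancel _ _ _ h1, rinv]
  · obtain ⟨d, h1, h2, h3⟩ := H.exists_gcd (rev f) (rev g)
    refine ⟨rev d, (hdvd' _ _).2 h1, (hdvd' _ _).2 h2, fun c hf hg => (hdvd'' _ _).2 ?_⟩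
    exact h3 _ ((hdvd _ _).1 hf) ((hdvd _ _).1 hg)
  · obtain ⟨m, h1, h2, h3⟩ := H.exists_lcm (rev f) (rev g)
    refine ⟨rev m, (hdvd'' _ _).2 h1, (hdvd'' _ _).2 h2, fun c hf hg => (hdvd' _ _).2 ?_⟩
    exact h3 _ ((hdvd _ _).1 hf) ((hdvd _ _).1 hg)
  · ext f
    rw [Set.mem_ofPred_eq, Set.mem_ofPred_eq, hdvd, htop, H.dvd_intervalTop_iff,
      H.dvd_intervalTop_iff]
    exact ⟨hrange f, fun h => by simpa [rinv] using hrange _ h⟩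

end IsJoinInterval

/-- A Garside monoid has a group of fractions. -/
theorem IsGarsideMonoid.exists_isGroupOfFractions.{u} {M : Type u} [Monoid M] {Δ : M}
    (h : IsGarsideMonoid M Δ) :
    ∃ (Γ : Type u) (_ : Group Γ) (ι : M →* Γ), IsGroupOfFractions ι := by
  refine _root_.exists_isGroupOfFractions h.left_cancel h.right_cancel (fun f g => ?_)
    (fun f g => ?_)
  · obtain ⟨m, ⟨a, ha⟩, ⟨b, hb⟩, -⟩ := h.exists_right_lcm f g
    exact ⟨a, b, ha.symm.trans hb⟩
  · obtain ⟨m, ⟨a, ha⟩, ⟨b, hb⟩, -⟩ := h.exists_lcm f g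
    exact ⟨a, b, ha.symm.trans hb⟩

/-! ### Joins from joins of atoms -/

section AtomJoins

variable {G : Type*} [Group G] {S : Set G} {w : G}

/-- Least upper bounds of pairs of generators yield least upper bounds of all pairs. -/
theorem exists_join_of_atoms
    (hsub : ∀ g h : G, wordLength S (g * h) ≤ wordLength S g + wordLength S h)
    (hquot : ∀ u v : G, LengthDvd S u v → v ∈ lengthInterval S w → u⁻¹ * v ∈ lengthInterval S w)
    (hlen : ∀ s ∈ S, wordLength S s = 1)
    (hatom : ∀ g : G, g ≠ 1 → ∃ s ∈ S, LengthDvd S s g)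
    (hjoin : ∀ s ∈ S, ∀ t ∈ S, ∃ j, LengthDvd S s j ∧ LengthDvd S t j ∧
      ∀ x ∈ lengthInterval S w, LengthDvd S s x → LengthDvd S t x → LengthDvd S j x)
    (u : G) (hu : u ∈ lengthInterval S w) (v : G) (hv : v ∈ lengthInterval S w) :
    ∃ j ∈ lengthInterval S w, LengthDvd S u j ∧ LengthDvd S v j ∧
      ∀ x ∈ lengthInterval S w, LengthDvd S u x → LengthDvd S v x → LengthDvd S j x := by
  have hmem : ∀ {u v : G}, LengthDvd S u v → v ∈ lengthInterval S w → u ∈ lengthInterval S w :=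
    fun h hv => mem_lengthInterval.2 (h.trans hsub (mem_lengthInterval.1 hv))
  have hle : ∀ {u : G}, u ∈ lengthInterval S w → wordLength S u ≤ wordLength S w := by
    intro u hu
    have := lengthDvd_iff.1 (mem_lengthInterval.1 hu)
    omega
  -- Induction on the room left above a common divisor `f` of `u` and `v`, starting from `f = 1`.
  suffices key : ∀ (N : ℕ) (f u v : G), wordLength S w - wordLength S f ≤ N →
      LengthDvd S f u → LengthDvd S f v → u ∈ lengthInterval S w → v ∈ lengthInterval S w →
      ∃ j ∈ lengthInterval S w, LengthDvd S u j ∧ LengthDvd S v j ∧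
        ∀ x ∈ lengthInterval S w, LengthDvd S u x → LengthDvd S v x → LengthDvd S j x from
    key _ 1 u v le_rfl (one_lengthDvd u) (one_lengthDvd v) hu hv
  have step : ∀ {f u : G}, LengthDvd S f u → f ≠ u → ∃ s ∈ S, LengthDvd S s (f⁻¹ * u) ∧
      LengthDvd S f (f * s) ∧ LengthDvd S (f * s) u ∧
        wordLength S (f * s) = wordLength S f + 1 := by
    intro f u hfu hne
    obtain ⟨s, hs, hsq⟩ := hatom (f⁻¹ * u) (fun h => hne (inv_mul_eq_one.1 h))
    obtain ⟨h1, h2⟩ := hfu.mul_of_quotient hsub hsq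
    refine ⟨s, hs, hsq, h1, h2, ?_⟩
    have := lengthDvd_iff.1 h1
    rwa [inv_mul_cancel_left, hlen s hs] at this
  intro N
  induction N with
  | zero =>
    intro f u v hN hfu hfv hu hv
    have hf : f = u := by
      by_contra hne
      obtain ⟨s, -, -, -, h1, h2⟩ := step hfu hne
      have := hle (hmem h1 hu)
      omega
    subst hf
    exact ⟨v, hv, hfv, lengthDvd_refl v, fun x _ _ h => h⟩
  | succ N ih =>
    intro f u v hN hfu hfv hu hv
    by_cases hne : f = u
    · subst hne
      exact ⟨v, hv, hfv, lengthDvd_refl v, fun x _ _ h => h⟩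
    by_cases hne' : f = v
    · subst hne'
      exact ⟨u, hu, lengthDvd_refl u, hfu, fun x _ h _ => h⟩
    obtain ⟨s, hs, hsq, hfs, hsu, hls⟩ := step hfu hne
    obtain ⟨t, ht, htq, hft, htv, hlt⟩ := step hfv hne'
    have hfw := mem_lengthInterval.1 (hmem hfu hu)
    have lift : ∀ {x : G} {r : G}, LengthDvd S f (f * r) → LengthDvd S f x →
        LengthDvd S (f * r) x → LengthDvd S r (f⁻¹ * x) := by
      intro x r h1 h2 h3
      simpa using h1.quotient hsub h3
    obtain ⟨j, hsj, htj, hj⟩ := hjoin s hs t ht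
    have hww := self_mem_lengthInterval S w
    -- The quotient `f⁻¹ * w` is an element of the interval above both `s` and `t`, so `f * j` stays
    -- below `w`.
    have hjw : LengthDvd S j (f⁻¹ * w) := hj _ (hquot _ _ hfw hww)
      (lift hfs hfw (hsu.trans hsub (mem_lengthInterval.1 hu)))
      (lift hft hfw (htv.trans hsub (mem_lengthInterval.1 hv)))
    obtain ⟨hfj, hfjw⟩ := hfw.mul_of_quotient hsub hjw
    have hfjm := mem_lengthInterval.2 hfjw
    have hsfj : LengthDvd S (f * s) (f * j) :=
      hfs.of_quotient hfj (by simpa using hsj)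
    have htfj : LengthDvd S (f * t) (f * j) :=
      hft.of_quotient hfj (by simpa using htj)
    -- The pair `u`, `f * j` has the longer common divisor `f * s`; the resulting join `p` and `v`
    -- have the longer common divisor `f * t`.
    obtain ⟨p, hp, hup, hjp, hpl⟩ := ih (f * s) u (f * j) (by omega) hsu hsfj hu hfjm
    obtain ⟨q, hq, hpq, hvq, hql⟩ := ih (f * t) p v (by omega) (htfj.trans hsub hjp) htv hp hv
    refine ⟨q, hq, hup.trans hsub hpq, hvq, fun x hx hux hvx => hql x hx (hpl x hx hux ?_) hvx⟩
    have hfx := hfu.trans hsub hux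
    exact hfj.of_quotient hfx (by
      rw [inv_mul_cancel_left]
      exact hj _ (hquot _ _ hfx hx) (lift hfs hfx (hsu.trans hsub hux))
        (lift hft hfx (htv.trans hsub hvx)))

end AtomJoins

/-! ### Permutation and entries of an element of `G(e,e,n)` -/

section Monomial

variable {e n : ℕ}

theorem IsMonomialWith.unique {A : Matrix (Fin n) (Fin n) ℂ} {σ τ : Equiv.Perm (Fin n)}
    {a b : Fin n → ℂ} (hA : IsMonomialWith A σ a) (hB : IsMonomialWith A τ b)
    (ha : ∀ i, a i ≠ 0) : σ = τ ∧ a = b := by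
  have h : ∀ i, σ i = τ i ∧ a i = b i := by
    intro i
    have h1 := hA i (σ i)
    rw [hB i (σ i), if_pos rfl] at h1
    split_ifs at h1 with h
    · exact ⟨h.symm, h1.symm⟩
    · exact absurd h1.symm (ha i)
  exact ⟨Equiv.ext fun i => (h i).1, funext fun i => (h i).2⟩

theorem IsMonomialWith.eq {A B : Matrix (Fin n) (Fin n) ℂ} {σ : Equiv.Perm (Fin n)}
    {a : Fin n → ℂ} (hA : IsMonomialWith A σ a) (hB : IsMonomialWith B σ a) : A = B := by
  ext i j
  rw [hA, hB]

/-- The permutation underlying an element of `G(e,e,n)`: row `i` is supported in column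
`geenPerm g i`. -/
noncomputable def geenPerm (g : Geen e n) : Equiv.Perm (Fin n) := Classical.choose g.2

/-- The nonzero entry of row `i` of an element of `G(e,e,n)`. -/
noncomputable def geenVal (g : Geen e n) : Fin n → ℂ :=
  Classical.choose (Classical.choose_spec g.2)

theorem geen_isMonomialWith (g : Geen e n) :
    IsMonomialWith ((g : GL (Fin n) ℂ) : Matrix (Fin n) (Fin n) ℂ) (geenPerm g) (geenVal g) :=
  (Classical.choose_spec (Classical.choose_spec g.2)).1

theorem geenVal_pow (g : Geen e n) (i : Fin n) : geenVal g i ^ e = 1 :=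
  (Classical.choose_spec (Classical.choose_spec g.2)).2.1 i

theorem prod_geenVal (g : Geen e n) : ∏ i, geenVal g i = 1 :=
  (Classical.choose_spec (Classical.choose_spec g.2)).2.2

theorem geenVal_ne_zero (g : Geen e n) (i : Fin n) : geenVal g i ≠ 0 := by
  intro h0
  have h := Finset.prod_eq_zero (Finset.mem_univ i) h0
  rw [prod_geenVal] at h
  exact one_ne_zero h

theorem geen_eq_of_isMonomialWith {g : Geen e n} {σ : Equiv.Perm (Fin n)} {a : Fin n → ℂ}
    (h : IsMonomialWith ((g : GL (Fin n) ℂ) : Matrix (Fin n) (Fin n) ℂ) σ a) :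
    geenPerm g = σ ∧ geenVal g = a :=
  (geen_isMonomialWith g).unique h (geenVal_ne_zero g)

theorem geen_ext {g h : Geen e n} (hp : ∀ i, geenPerm g i = geenPerm h i)
    (hv : ∀ i, geenVal g i = geenVal h i) : g = h := by
  have h1 := geen_isMonomialWith g
  rw [Equiv.ext hp, funext hv] at h1
  exact Subtype.ext (Units.ext (h1.eq (geen_isMonomialWith h)))

theorem geenPerm_mul (g h : Geen e n) : geenPerm (g * h) = geenPerm h * geenPerm g :=
  (geen_eq_of_isMonomialWith (g := g * h)
    (by simpa using (geen_isMonomialWith g).mul (geen_isMonomialWith h))).1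

theorem geenVal_mul (g h : Geen e n) (i : Fin n) :
    geenVal (g * h) i = geenVal g i * geenVal h (geenPerm g i) :=
  congrFun (geen_eq_of_isMonomialWith (g := g * h)
    (by simpa using (geen_isMonomialWith g).mul (geen_isMonomialWith h))).2 i

theorem geen_one_isMonomialWith :
    IsMonomialWith (((1 : Geen e n) : GL (Fin n) ℂ) : Matrix (Fin n) (Fin n) ℂ) 1 fun _ => 1 := by
  intro i j
  simp [Matrix.one_apply]
  rfl

theorem geenPerm_one : geenPerm (1 : Geen e n) = 1 :=
  (geen_eq_of_isMonomialWith geen_one_isMonomialWith).1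

theorem geenVal_one (i : Fin n) : geenVal (1 : Geen e n) i = 1 :=
  congrFun (geen_eq_of_isMonomialWith geen_one_isMonomialWith).2 i

/-- A permutation and `e`-th roots of unity with product `1` define an element of `G(e,e,n)`. -/
theorem exists_geen (σ : Equiv.Perm (Fin n)) (a : Fin n → ℂ) (ha : ∀ i, a i ^ e = 1)
    (ha1 : ∏ i, a i = 1) : ∃ g : Geen e n, geenPerm g = σ ∧ geenVal g = a := by
  have hne : ∀ i, a i ≠ 0 := fun i h0 => by
    have h := Finset.prod_eq_zero (Finset.mem_univ i) h0
    rw [ha1] at h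
    exact one_ne_zero h
  have hA : IsMonomialWith (Matrix.of fun i j => if σ i = j then a i else 0) σ a :=
    fun i j => rfl
  have hB : IsMonomialWith (Matrix.of fun i j => if σ⁻¹ i = j then (a (σ⁻¹ i))⁻¹ else 0) σ⁻¹
    (fun i => (a (σ⁻¹ i))⁻¹) := fun i j => rfl
  have hAB := hA.mul hB
  have h1 : (Matrix.of fun i j => if σ i = j then a i else 0) *
      (Matrix.of fun i j => if σ⁻¹ i = j then (a (σ⁻¹ i))⁻¹ else 0) =
        (1 : Matrix (Fin n) (Fin n) ℂ) := by
    ext i j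
    rw [hAB i j]
    simp [Matrix.one_apply, hne]
  exact ⟨⟨Matrix.GeneralLinearGroup.mkOfDetNeZero _ (Matrix.det_ne_zero_of_right_inverse h1),
    σ, a, hA, ha, ha1⟩, geen_eq_of_isMonomialWith hA⟩

theorem geen_finite (he : 0 < e) : Finite (Geen e n) := by
  have hroots : {z : ℂ | z ^ e = 1}.Finite := by
    refine (Polynomial.nthRoots e (1 : ℂ)).toFinset.finite_toSet.subset fun z hz => ?_
    simpa [Polynomial.mem_nthRoots he] using hz
  have := hroots.to_subtype
  refine Finite.of_injective (β := Equiv.Perm (Fin n) × (Fin n → {z : ℂ | z ^ e = 1}))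
    (fun g => (geenPerm g, fun i => ⟨geenVal g i, geenVal_pow g i⟩)) fun g h hgh => ?_
  rw [Prod.mk.injEq] at hgh
  exact geen_ext (fun i => by rw [hgh.1])
    fun i => congrArg Subtype.val (congrFun hgh.2 i)

/-- Transposition of elements of `G(e,e,n)`. -/
theorem exists_geen_transpose (g : Geen e n) : ∃ h : Geen e n, geenPerm h = (geenPerm g)⁻¹ ∧
    geenVal h = fun i => geenVal g ((geenPerm g)⁻¹ i) :=
  exists_geen _ _ (fun _ => geenVal_pow g _)
    ((Equiv.prod_comp (geenPerm g)⁻¹ (geenVal g)).trans (prod_geenVal g))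

/-- The transpose of an element of `G(e,e,n)`. -/
noncomputable def geenTranspose (g : Geen e n) : Geen e n :=
  Classical.choose (exists_geen_transpose g)

theorem geenPerm_transpose (g : Geen e n) : geenPerm (geenTranspose g) = (geenPerm g)⁻¹ :=
  (Classical.choose_spec (exists_geen_transpose g)).1

theorem geenVal_transpose (g : Geen e n) (i : Fin n) :
    geenVal (geenTranspose g) i = geenVal g ((geenPerm g)⁻¹ i) :=
  congrFun (Classical.choose_spec (exists_geen_transpose g)).2 i

theorem geenTranspose_mul (g h : Geen e n) :
    geenTranspose (g * h) = geenTranspose h * geenTranspose g := by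
  refine geen_ext (fun i => ?_) fun i => ?_
  · simp [geenPerm_transpose, geenPerm_mul]
  · simp [geenPerm_transpose, geenVal_transpose, geenPerm_mul, geenVal_mul, mul_comm]

theorem geenTranspose_transpose (g : Geen e n) : geenTranspose (geenTranspose g) = g :=
  geen_ext (fun i => by simp [geenPerm_transpose])
    fun i => by simp [geenPerm_transpose, geenVal_transpose]

/-! ### The generators as row operations -/

/-- The entries of the monomial matrix that swaps the rows `p` and `q`, scaled by `z`. -/
noncomputable def rowSwapVal (p q : Fin n) (z : ℂ) (i : Fin n) : ℂ :=
  if i = p then z⁻¹ else if i = q then z else 1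

/-- `g` is a Corran–Picantin generator: it swaps the consecutive rows `p` and `q`, up to the
scalar `z`, which is `1` unless `p` is the first row. -/
structure IsRowSwap (g : Geen e n) (p q : Fin n) (z : ℂ) : Prop where
  succ : p.val + 1 = q.val
  pow_eq : z ^ e = 1
  scalar : p.val ≠ 0 → z = 1
  perm : geenPerm g = Equiv.swap p q
  val : geenVal g = rowSwapVal p q z

theorem tMatrix_isMonomialWith {p q : Fin n} (hp : p.val = 0) (hq : q.val = 1) (i : ℕ) :
    IsMonomialWith (tMatrix e n i) (Equiv.swap p q) (rowSwapVal p q (zetaRoot e ^ i)) := by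
  intro r c
  simp only [tMatrix, Matrix.of_apply, Equiv.swap_apply_def, rowSwapVal, Fin.ext_iff, hp, hq,
    inv_pow]
  split_ifs <;> first | rfl | (exfalso; omega)

theorem sMatrix_isMonomialWith {p q : Fin n} {j : ℕ} (hp : p.val + 2 = j) (hq : q.val + 1 = j) :
    IsMonomialWith (sMatrix n j) (Equiv.swap p q) (rowSwapVal p q 1) := by
  intro r c
  simp only [sMatrix, Matrix.of_apply, Equiv.swap_apply_def, rowSwapVal, Fin.ext_iff, inv_one,
    ite_self]
  split_ifs <;> first | rfl | (exfalso; omega)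

/-- This treats the `t_i` and the `s_j` uniformly: every `e`-th root of unity is some `ζ_e ^ i` with
`i < e`, so the swaps of the first two rows are exactly the `t_i`. -/
theorem mem_corranPicantinGens_iff (he : 0 < e) (hn : 2 ≤ n) {g : Geen e n} :
    g ∈ corranPicantinGens e n ↔ ∃ p q z, IsRowSwap g p q z := by
  constructor
  · rintro (⟨i, hi, hg⟩ | ⟨j, hj, hjn, hg⟩)
    · have h := tMatrix_isMonomialWith (e := e) (p := (⟨0, by omega⟩ : Fin n))
        (q := ⟨1, by omega⟩) rfl rfl i
      rw [← hg] at h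
      obtain ⟨h1, h2⟩ := geen_eq_of_isMonomialWith h
      refine ⟨_, _, _, rfl, ?_, fun h => absurd rfl h, h1, h2⟩
      rw [← pow_mul, mul_comm, pow_mul, zetaRoot_pow, one_pow]
    · have h := sMatrix_isMonomialWith (p := (⟨j - 2, by omega⟩ : Fin n))
        (q := ⟨j - 1, by omega⟩) (j := j) (by simp only; omega) (by simp only; omega)
      rw [← hg] at h
      obtain ⟨h1, h2⟩ := geen_eq_of_isMonomialWith h
      exact ⟨_, _, _, by simp only; omega, one_pow _, fun _ => rfl, h1, h2⟩
  · rintro ⟨p, q, z, hpq, hz, hz1, h1, h2⟩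
    have h := geen_isMonomialWith g
    rw [h1, h2] at h
    by_cases hp : p.val = 0
    · have : NeZero e := ⟨he.ne'⟩
      obtain ⟨i, hi, rfl⟩ := (Complex.isPrimitiveRoot_exp e he.ne').eq_pow_of_pow_eq_one hz
      exact Or.inl ⟨i, hi, h.eq (tMatrix_isMonomialWith hp (by omega) i)⟩
    · rw [hz1 hp] at h
      exact Or.inr ⟨p.val + 2, by omega, by omega,
        h.eq (sMatrix_isMonomialWith rfl (by omega))⟩

theorem exists_isRowSwap {p q : Fin n} {z : ℂ} (hpq : p.val + 1 = q.val) (hz : z ^ e = 1)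
    (hz1 : p.val ≠ 0 → z = 1) (he : 0 < e) : ∃ g : Geen e n, IsRowSwap g p q z := by
  have hz0 : z ≠ 0 := by
    rintro rfl
    rw [zero_pow he.ne'] at hz
    exact zero_ne_one hz
  have hne : q ≠ p := by
    rintro rfl
    omega
  obtain ⟨g, h1, h2⟩ := exists_geen (e := e) (Equiv.swap p q) (rowSwapVal p q z)
    (fun i => by unfold rowSwapVal; split_ifs <;> simp [hz]) (by
      rw [← Finset.prod_subset (Finset.subset_univ {p, q}) (fun i _ hi => ?_),
        Finset.prod_pair hne.symm]
      · simp [rowSwapVal, hne, hz0]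
      · simp only [Finset.mem_insert, Finset.mem_singleton, not_or] at hi
        simp [rowSwapVal, hi.1, hi.2])
  exact ⟨g, hpq, hz, hz1, h1, h2⟩

namespace IsRowSwap

variable {g : Geen e n} {p q : Fin n} {z : ℂ}

theorem ne (h : IsRowSwap g p q z) : p ≠ q := by
  rintro rfl
  have := h.succ
  omega

theorem lt (h : IsRowSwap g p q z) : p < q := by
  have := h.succ
  rw [Fin.lt_def]
  omega

theorem scalar_ne_zero (h : IsRowSwap g p q z) : z ≠ 0 := by
  have h1 := geenVal_ne_zero g q
  rw [h.val] at h1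
  simpa [rowSwapVal, h.ne.symm] using h1

theorem unique {g' : Geen e n} (h : IsRowSwap g p q z) (h' : IsRowSwap g' p q z) : g = g' :=
  geen_ext (fun i => by rw [h.perm, h'.perm]) fun i => by rw [h.val, h'.val]

theorem perm_mul (h : IsRowSwap g p q z) (x : Geen e n) (i : Fin n) :
    geenPerm (g * x) i =
      if i = p then geenPerm x q else if i = q then geenPerm x p else geenPerm x i := by
  rw [geenPerm_mul, h.perm, Equiv.Perm.mul_apply, Equiv.swap_apply_def]
  split_ifs <;> rfl

theorem val_mul (h : IsRowSwap g p q z) (x : Geen e n) (i : Fin n) :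
    geenVal (g * x) i =
      if i = p then z⁻¹ * geenVal x q else if i = q then z * geenVal x p else geenVal x i := by
  rw [geenVal_mul, h.perm, h.val, Equiv.swap_apply_def, rowSwapVal]
  split_ifs <;> simp

theorem mul_self (h : IsRowSwap g p q z) : g * g = 1 := by
  have hne := h.ne
  have hz := h.scalar_ne_zero
  refine geen_ext (fun i => ?_) fun i => ?_
  · rw [geenPerm_mul, h.perm, geenPerm_one, Equiv.swap_mul_self]
  · rw [h.val_mul, h.val, geenVal_one]
    unfold rowSwapVal
    split_ifs <;> simp_all

theorem inv_eq (h : IsRowSwap g p q z) : g⁻¹ = g := inv_eq_of_mul_eq_one_left h.mul_self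

theorem transpose (h : IsRowSwap g p q z) : IsRowSwap (geenTranspose g) p q z⁻¹ := by
  have hne := h.ne
  refine ⟨h.succ, by simp [h.pow_eq], fun hp => by simp [h.scalar hp], ?_, ?_⟩
  · rw [geenPerm_transpose, h.perm, Equiv.swap_inv]
  · funext i
    rw [geenVal_transpose, h.perm, Equiv.swap_inv, h.val, Equiv.swap_apply_def]
    unfold rowSwapVal
    split_ifs <;> simp_all

end IsRowSwap

/-! ### The length function -/

/-- The contribution of the rows `j < i` to the length. -/
noncomputable def pairLength (g : Geen e n) (j i : Fin n) : ℕ :=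
  open Classical in
  if j < i then (if geenPerm g i < geenPerm g j then 1 else if geenVal g i = 1 then 0 else 2) else 0

/-- The length of an element of `G(e,e,n)`, read off its matrix. -/
noncomputable def geenLength (g : Geen e n) : ℕ := ∑ x : Fin n × Fin n, pairLength g x.1 x.2

/-- Left multiplication by the generator that swaps the rows `p` and `q` with scalar `z` shortens
`g`. -/
def IsDescent (g : Geen e n) (p q : Fin n) (z : ℂ) : Prop :=
  (geenPerm g q < geenPerm g p ∧ z * geenVal g p = 1) ∨
    (geenPerm g p < geenPerm g q ∧ geenVal g q ≠ 1)

theorem swap_lt_swap_iff {p q i j : Fin n} (hpq : p.val + 1 = q.val) (h : ¬(j = p ∧ i = q))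
    (h' : ¬(j = q ∧ i = p)) : Equiv.swap p q j < Equiv.swap p q i ↔ j < i := by
  simp only [Equiv.swap_apply_def, Fin.ext_iff, Fin.lt_def] at *
  split_ifs <;> omega

/-- A nontrivial scalar only affects the first two rows, and `pairLength` reads the entry of the
larger row index only. That row is one of the first two only for the pair `(p, q)`, which is
excluded. -/
theorem IsRowSwap.pairLength_mul {g : Geen e n} {p q : Fin n} {z : ℂ} (h : IsRowSwap g p q z)
    (x : Geen e n) {j i : Fin n} (h1 : ¬(j = p ∧ i = q)) (h2 : ¬(j = q ∧ i = p)) :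
    pairLength (g * x) j i = pairLength x (Equiv.swap p q j) (Equiv.swap p q i) := by
  unfold pairLength
  simp only [swap_lt_swap_iff h.succ h1 h2]
  by_cases hji : j < i
  · have hv : geenVal (g * x) i = geenVal x (Equiv.swap p q i) := by
      rw [geenVal_mul, h.perm, h.val]
      have : rowSwapVal p q z i = 1 := by
        by_cases hp : p.val = 0
        · have hip : i ≠ p := by
            rintro rfl
            rw [Fin.lt_def] at hji
            omega
          have hiq : i ≠ q := by
            rintro rfl
            have := h.succ
            rw [Fin.lt_def] at hji
            exact h1 ⟨Fin.ext (by omega), rfl⟩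
          simp [rowSwapVal, hip, hiq]
        · simp [rowSwapVal, h.scalar hp]
      rw [this, one_mul]
    rw [hv, geenPerm_mul, h.perm]
    rfl
  · simp [hji]

/-- Reindexing by the swap matches all pairs except `(p, q)`, so the two lengths differ only by its
contribution. The additive form avoids truncated subtraction. -/
theorem IsRowSwap.geenLength_mul_add {g : Geen e n} {p q : Fin n} {z : ℂ}
    (h : IsRowSwap g p q z) (x : Geen e n) :
    geenLength (g * x) + pairLength x p q = geenLength x + pairLength (g * x) p q := by
  have hx : geenLength x =
      ∑ y : Fin n × Fin n, pairLength x (Equiv.swap p q y.1) (Equiv.swap p q y.2) :=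
    (Equiv.sum_comp ((Equiv.swap p q).prodCongr (Equiv.swap p q))
      (fun y : Fin n × Fin n => pairLength x y.1 y.2)).symm
  have e1 : pairLength x p q =
      ∑ y : Fin n × Fin n, if y = (q, p) then pairLength x p q else 0 := by simp
  have e2 : pairLength (g * x) p q =
      ∑ y : Fin n × Fin n, if y = (p, q) then pairLength (g * x) p q else 0 := by simp
  rw [hx, e1, e2, geenLength, ← Finset.sum_add_distrib, ← Finset.sum_add_distrib]
  refine Finset.sum_congr rfl fun y _ => ?_
  obtain ⟨j, i⟩ := y
  have hne := h.ne
  have hnot := h.lt.not_gt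
  by_cases h1 : j = p ∧ i = q
  · obtain ⟨rfl, rfl⟩ := h1
    simp [hne, pairLength, hnot]
  by_cases h2 : j = q ∧ i = p
  · obtain ⟨rfl, rfl⟩ := h2
    simp [hne.symm, pairLength, hnot]
  simp only [Prod.mk.injEq, h1, h2, if_false, add_zero]
  exact h.pairLength_mul x h1 h2

theorem IsRowSwap.geenLength_of_isDescent {g : Geen e n} {p q : Fin n} {z : ℂ}
    (h : IsRowSwap g p q z) {x : Geen e n} (hx : IsDescent x p q z) :
    geenLength x = geenLength (g * x) + 1 := by
  have := h.geenLength_mul_add x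
  have e1 : pairLength x p q = pairLength (g * x) p q + 1 := by
    have hne := h.ne.symm
    simp only [pairLength, h.lt, if_true, h.perm_mul, h.val_mul, hne, if_false]
    rcases hx with ⟨h1, h2⟩ | ⟨h1, h2⟩
    · simp [h1, h1.not_gt, h2]
    · simp [h1, h1.not_gt, h2]
  omega

theorem IsRowSwap.geenLength_of_not_isDescent {g : Geen e n} {p q : Fin n} {z : ℂ}
    (h : IsRowSwap g p q z) {x : Geen e n} (hx : ¬IsDescent x p q z) :
    geenLength (g * x) = geenLength x + 1 := by
  have := h.geenLength_mul_add x
  have e1 : pairLength (g * x) p q = pairLength x p q + 1 := by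
    have hne := h.ne.symm
    simp only [IsDescent, not_or, not_and, not_not] at hx
    simp only [pairLength, h.lt, if_true, h.perm_mul, h.val_mul, hne, if_false]
    rcases lt_or_gt_of_ne ((geenPerm x).injective.ne h.ne) with h1 | h1
    · simp [h1, h1.not_gt, hx.2 h1]
    · simp [h1, h1.not_gt, hx.1 h1]
  omega

/-- Without descents, the rows are in increasing order and all entries outside the first row are
`1`, by induction along the rows; the first entry is then `1` because the product is. -/
theorem exists_isDescent {x : Geen e n} (hx : x ≠ 1) :
    ∃ p q z, p.val + 1 = q.val ∧ z ^ e = 1 ∧ (p.val ≠ 0 → z = 1) ∧ IsDescent x p q z := by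
  by_contra! hno
  apply hx
  have key : ∀ (m : ℕ) (p q : Fin n), p.val = m → p.val + 1 = q.val →
      geenPerm x p < geenPerm x q ∧ geenVal x q = 1 := by
    intro m
    induction m with
    | zero =>
      intro p q hp hpq
      have hlt : geenPerm x p < geenPerm x q := by
        by_contra hlt
        -- On the first two rows every scalar is available, so an inversion is always a descent for
        -- a suitable one.
        refine hno p q (geenVal x p)⁻¹ hpq (by simp [geenVal_pow]) (fun h => absurd hp h)
          (Or.inl ⟨lt_of_le_of_ne (not_lt.1 hlt) ?_, inv_mul_cancel₀ (geenVal_ne_zero x p)⟩)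
        refine (geenPerm x).injective.ne fun hqp => ?_
        rw [hqp] at hpq
        omega
      refine ⟨hlt, ?_⟩
      by_contra hv
      exact hno p q 1 hpq (one_pow _) (fun _ => rfl) (Or.inr ⟨hlt, hv⟩)
    | succ m ih =>
      intro p q hp hpq
      -- Further down only the scalar `1` is allowed, but the entry of row `p` is already known to
      -- be `1`.
      have hv := (ih ⟨m, by omega⟩ p rfl hp.symm).2
      have hlt : geenPerm x p < geenPerm x q := by
        by_contra hlt
        refine hno p q 1 hpq (one_pow _) (fun _ => rfl)
          (Or.inl ⟨lt_of_le_of_ne (not_lt.1 hlt) ?_, by rw [hv, one_mul]⟩)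
        refine (geenPerm x).injective.ne fun hqp => ?_
        rw [hqp] at hpq
        omega
      refine ⟨hlt, ?_⟩
      by_contra hv
      exact hno p q 1 hpq (one_pow _) (fun _ => rfl) (Or.inr ⟨hlt, hv⟩)
  have hval : ∀ i : Fin n, i.val ≠ 0 → geenVal x i = 1 := fun i hi =>
    (key (i.val - 1) ⟨i.val - 1, by omega⟩ i rfl (by simp only; omega)).2
  have hmono : StrictMono (geenPerm x) := by
    have : ∀ (d : ℕ) (i j : Fin n), i.val + d + 1 = j.val → geenPerm x i < geenPerm x j := by
      intro d
      induction d with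
      | zero => exact fun i j hij => (key _ i j rfl hij).1
      | succ d ih =>
        intro i j hij
        have h1 := ih i ⟨i.val + d + 1, by omega⟩ rfl
        exact h1.trans (key _ _ j rfl hij).1
    intro i j hij
    rw [Fin.lt_def] at hij
    exact this (j.val - i.val - 1) i j (by omega)
  have hperm : ∀ i, geenPerm x i = i := by
    have h1 : (hmono.orderIsoOfSurjective _ (geenPerm x).surjective) = OrderIso.refl (Fin n) :=
      Subsingleton.elim _ _
    exact fun i => congrArg (fun f : Fin n ≃o Fin n => f i) h1
  refine geen_ext (fun i => by rw [hperm, geenPerm_one]; rfl) fun i => ?_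
  rw [geenVal_one]
  by_cases hi : i.val = 0
  · rw [← prod_geenVal x]
    refine (Finset.prod_eq_single i (fun j _ hj => hval j fun h => hj (Fin.ext ?_)) ?_).symm
    · rw [h, hi]
    · exact fun h => absurd (Finset.mem_univ i) h
  · exact hval i hi

theorem geenLength_one : geenLength (1 : Geen e n) = 0 := by
  refine Finset.sum_eq_zero fun x _ => ?_
  unfold pairLength
  split_ifs with h1 h2 h3
  · rw [geenPerm_one] at h2
    exact absurd h2 h1.not_gt
  · rfl
  · exact absurd (geenVal_one _) h3
  · rfl

theorem exists_word (he : 0 < e) (hn : 2 ≤ n) (x : Geen e n) :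
    ∃ l : List (Geen e n), (∀ y ∈ l, y ∈ corranPicantinGens e n) ∧ l.prod = x ∧
      l.length = geenLength x := by
  induction hN : geenLength x generalizing x with
  | zero =>
    by_cases hx : x = 1
    · exact ⟨[], by simp, by simp [hx], by simp⟩
    · obtain ⟨p, q, z, hpq, hz, hz1, hd⟩ := exists_isDescent hx
      obtain ⟨g, hg⟩ := exists_isRowSwap hpq hz hz1 he
      have := hg.geenLength_of_isDescent hd
      omega
  | succ N ih =>
    have hx : x ≠ 1 := by
      rintro rfl
      rw [geenLength_one] at hN
      omega
    obtain ⟨p, q, z, hpq, hz, hz1, hd⟩ := exists_isDescent hx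
    obtain ⟨g, hg⟩ := exists_isRowSwap hpq hz hz1 he
    have := hg.geenLength_of_isDescent hd
    obtain ⟨l, hl, hprod, hlen⟩ := ih (g * x) (by omega)
    refine ⟨g :: l, ?_, ?_, by simp [hlen]⟩
    · intro y hy
      rcases List.mem_cons.1 hy with rfl | hy
      · exact (mem_corranPicantinGens_iff he hn).2 ⟨p, q, z, hg⟩
      · exact hl y hy
    · rw [List.prod_cons, hprod, ← mul_assoc, hg.mul_self, one_mul]

theorem geenLength_prod_le (he : 0 < e) (hn : 2 ≤ n) (l : List (Geen e n))
    (hl : ∀ y ∈ l, y ∈ corranPicantinGens e n) : geenLength l.prod ≤ l.length := by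
  induction l with
  | nil => simp [geenLength_one]
  | cons g l ih =>
    have h1 := ih fun y hy => hl y (List.mem_cons_of_mem _ hy)
    obtain ⟨p, q, z, hg⟩ := (mem_corranPicantinGens_iff he hn).1 (hl g List.mem_cons_self)
    rw [List.prod_cons, List.length_cons]
    by_cases hd : IsDescent l.prod p q z
    · have := hg.geenLength_of_isDescent hd
      omega
    · have := hg.geenLength_of_not_isDescent hd
      omega

/-- The word length over the Corran–Picantin generators. -/
theorem wordLength_eq_geenLength (he : 0 < e) (hn : 2 ≤ n) (x : Geen e n) :
    wordLength (corranPicantinGens e n) x = geenLength x := by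
  obtain ⟨l, hl, hprod, hlen⟩ := exists_word he hn x
  refine le_antisymm (Nat.sInf_le ⟨l, hl, hprod, hlen⟩) ?_
  refine le_csInf ⟨_, l, hl, hprod, hlen⟩ ?_
  rintro _ ⟨l', hl', rfl, rfl⟩
  exact geenLength_prod_le he hn l' hl'

end Monomial

/-! ### Word length and anti-automorphisms -/

section WordLength

variable {G : Type*} [Group G] {S : Set G}

/-- Applying `ρ` letter by letter to the reversed word preserves its length; involutivity gives both
inequalities. -/
theorem wordLength_antiautomorphism {ρ : G → G} (hmul : ∀ g h, ρ (g * h) = ρ h * ρ g)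
    (hinv : ∀ g, ρ (ρ g) = g) (hS : ∀ g ∈ S, ρ g ∈ S) (g : G) :
    wordLength S (ρ g) = wordLength S g := by
  have hone : ρ 1 = 1 := by simpa using hmul 1 1
  have hprod : ∀ l : List G, (l.reverse.map ρ).prod = ρ l.prod := by
    intro l
    induction l with
    | nil => simp [hone]
    | cons a l ih =>
      rw [List.reverse_cons, List.map_append, List.prod_append, ih]
      simp [hmul]
  have hsub : ∀ g : G, {r : ℕ | ∃ l : List G, (∀ x ∈ l, x ∈ S) ∧ l.prod = g ∧ l.length = r} ⊆
      {r : ℕ | ∃ l : List G, (∀ x ∈ l, x ∈ S) ∧ l.prod = ρ g ∧ l.length = r} := by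
    rintro _ _ ⟨l, hl, rfl, rfl⟩
    refine ⟨l.reverse.map ρ, ?_, hprod l, by simp⟩
    intro x hx
    obtain ⟨y, hy, rfl⟩ := List.mem_map.1 hx
    exact hS y (hl y (List.mem_reverse.1 hy))
  unfold wordLength
  congr 1
  refine Set.Subset.antisymm ?_ (hsub g)
  have := hsub (ρ g)
  rwa [hinv] at this

end WordLength

/-! ### The interval below a power of `λ` -/

section Lambda

variable {e n k : ℕ}

theorem geenPerm_lam_pow (k : ℕ) : geenPerm (lam e n ^ k) = 1 := by
  induction k with
  | zero => rw [pow_zero, geenPerm_one]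
  | succ k ih =>
    have h : geenPerm (lam e n) = 1 := (geen_eq_of_isMonomialWith (g := lam e n) (fun i j => by
      simp [lam, Matrix.GeneralLinearGroup.mkOfDetNeZero, Matrix.diagonal_apply]; rfl)).1
    rw [pow_succ, geenPerm_mul, ih, h, one_mul]

theorem geenVal_lam_pow (k : ℕ) {i : Fin n} (hi : i.val ≠ 0) :
    geenVal (lam e n ^ k) i = zetaRoot e ^ k := by
  induction k with
  | zero => rw [pow_zero, geenVal_one, pow_zero]
  | succ k ih =>
    have h : geenVal (lam e n) = lamEntry e n :=
      (geen_eq_of_isMonomialWith (g := lam e n) (σ := 1) (fun i j => by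
        simp [lam, Matrix.GeneralLinearGroup.mkOfDetNeZero, Matrix.diagonal_apply]; rfl)).2
    rw [pow_succ, geenVal_mul, ih, h, geenPerm_lam_pow, Equiv.Perm.one_apply, lamEntry, if_neg hi,
      pow_succ]

theorem geenTranspose_lam_pow (k : ℕ) : geenTranspose (lam e n ^ k) = lam e n ^ k :=
  geen_ext (fun i => by rw [geenPerm_transpose, geenPerm_lam_pow, inv_one])
    fun i => by rw [geenVal_transpose, geenPerm_lam_pow, inv_one, Equiv.Perm.one_apply]

theorem zetaRoot_pow_ne_one (hk : 1 ≤ k) (hke : k ≤ e - 1) : zetaRoot e ^ k ≠ 1 :=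
  (Complex.isPrimitiveRoot_exp e (by omega)).pow_ne_one_of_pos_of_lt (by omega) (by omega)

/-- Multiplying by a power of `λ` on the left or on the right yields elements of equal length. -/
theorem geenLength_lam_pow_mul (k : ℕ) (u : Geen e n) :
    geenLength (lam e n ^ k * u) = geenLength (u * lam e n ^ k) := by
  refine Finset.sum_congr rfl fun x _ => ?_
  obtain ⟨j, i⟩ := x
  simp only [pairLength, geenPerm_mul, geenVal_mul, geenPerm_lam_pow, mul_one, one_mul,
    Equiv.Perm.one_apply]
  by_cases hji : j < i
  · by_cases hp : geenPerm u i < geenPerm u j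
    · simp [hji, hp]
    · have h1 : i.val ≠ 0 := by
        rw [Fin.lt_def] at hji
        omega
      -- Left and right multiplication scale row `i` by the entry of `λ ^ k` at its row and at its
      -- column respectively. In a non-inverted pair neither is the first, so both factors are `ζ_e
      -- ^ k`.
      have h2 : (geenPerm u i).val ≠ 0 := by
        have := (geenPerm u).injective.ne hji.ne
        rw [Ne, Fin.ext_iff] at this
        rw [Fin.lt_def] at hp
        omega
      rw [geenVal_lam_pow k h1, geenVal_lam_pow k h2, mul_comm]
  · simp [hji]

theorem isDescent_lam_pow (hk : 1 ≤ k) (hke : k ≤ e - 1) {p q : Fin n} (hpq : p.val + 1 = q.val)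
    (z : ℂ) : IsDescent (lam e n ^ k) p q z := by
  refine Or.inr ⟨?_, ?_⟩
  · rw [geenPerm_lam_pow, Equiv.Perm.one_apply, Equiv.Perm.one_apply, Fin.lt_def]
    omega
  · rw [geenVal_lam_pow k (by omega)]
    exact zetaRoot_pow_ne_one hk hke

/-- If `x` and its complement in `λ ^ k` have additive lengths, then the nonzero entry in a row
that is not a left-to-right minimum is `1` or `ζ_e ^ k`. -/
theorem geenVal_of_geenLength_add (hk : 1 ≤ k) (hke : k ≤ e - 1) {x : Geen e n}
    (hx : geenLength (lam e n ^ k) = geenLength x + geenLength ((lam e n ^ k)⁻¹ * x))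
    {j i : Fin n} (hji : j < i) (hp : geenPerm x j < geenPerm x i) (hi : geenVal x i ≠ 1) :
    geenVal x i = zetaRoot e ^ k := by
  have hζ := zetaRoot_pow_ne_one hk hke
  set y := (lam e n ^ k)⁻¹ * x with hy
  have hxy : x = lam e n ^ k * y := by rw [hy, mul_inv_cancel_left]
  have hperm : geenPerm x = geenPerm y := by
    rw [hxy, geenPerm_mul, geenPerm_lam_pow, mul_one]
  have hval : ∀ i : Fin n, i.val ≠ 0 → geenVal x i = zetaRoot e ^ k * geenVal y i := by
    intro i hi
    rw [hxy, geenVal_mul, geenPerm_lam_pow, geenVal_lam_pow k hi, Equiv.Perm.one_apply]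
  -- Subadditivity holds pair by pair: `2 ≤ 1 + 1` on inversions, and elsewhere `x` and `y` cannot
  -- both have entry `1` since `ζ_e ^ k ≠ 1`. Equality of the sums then forces equality at each
  -- pair.
  have hle : ∀ z ∈ (Finset.univ : Finset (Fin n × Fin n)), pairLength (lam e n ^ k) z.1 z.2 ≤
      pairLength x z.1 z.2 + pairLength y z.1 z.2 := by
    rintro ⟨j, i⟩ -
    by_cases hji : j < i
    · have h0 : i.val ≠ 0 := by
        rw [Fin.lt_def] at hji
        omega
      have h2 : pairLength (lam e n ^ k) j i ≤ 2 := by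
        unfold pairLength
        split_ifs <;> omega
      refine h2.trans ?_
      simp only [pairLength, hji, if_true, hperm]
      by_cases hp : geenPerm y i < geenPerm y j
      · simp [hp]
      · by_cases hy1 : geenVal y i = 1
        · simp [hp, hval i h0, hy1, hζ]
        · simp [hp, hy1]
    · simp [pairLength, hji]
  rw [geenLength, geenLength, geenLength, ← Finset.sum_add_distrib,
    Finset.sum_eq_sum_iff_of_le hle] at hx
  have h0 : i.val ≠ 0 := by
    rw [Fin.lt_def] at hji
    omega
  have h := hx (j, i) (Finset.mem_univ _)
  simp only [pairLength, hji, if_true, geenPerm_lam_pow, Equiv.Perm.one_apply, hji.not_gt,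
    if_false, geenVal_lam_pow k h0, hζ, hp.not_gt, hi, ← hperm] at h
  rw [hval i h0]
  split_ifs at h with h1
  · rw [h1, mul_one]
  · omega

/-! ### Word length, divisibility by generators, and stability under right factors. -/

theorem wordLength_mul_le (he : 0 < e) (hn : 2 ≤ n) (g h : Geen e n) :
    wordLength (corranPicantinGens e n) (g * h) ≤
      wordLength (corranPicantinGens e n) g + wordLength (corranPicantinGens e n) h := by
  obtain ⟨l, hl, rfl, hlen⟩ := exists_word he hn g
  obtain ⟨l', hl', rfl, hlen'⟩ := exists_word he hn h
  simp only [wordLength_eq_geenLength he hn]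
  rw [← hlen, ← hlen', ← List.prod_append, ← List.length_append]
  refine geenLength_prod_le he hn _ fun y hy => ?_
  rcases List.mem_append.1 hy with hy | hy
  exacts [hl y hy, hl' y hy]

theorem eq_one_of_wordLength_eq_zero (he : 0 < e) (hn : 2 ≤ n) {g : Geen e n}
    (hg : wordLength (corranPicantinGens e n) g = 0) : g = 1 := by
  obtain ⟨l, hl, rfl, hlen⟩ := exists_word he hn g
  rw [wordLength_eq_geenLength he hn] at hg
  rw [hg] at hlen
  rw [List.length_eq_zero_iff.1 hlen, List.prod_nil]

theorem wordLength_inv (he : 0 < e) (hn : 2 ≤ n) (g : Geen e n) :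
    wordLength (corranPicantinGens e n) g⁻¹ = wordLength (corranPicantinGens e n) g := by
  refine wordLength_antiautomorphism mul_inv_rev inv_inv (fun g hg => ?_) g
  obtain ⟨p, q, z, h⟩ := (mem_corranPicantinGens_iff he hn).1 hg
  rwa [h.inv_eq]

theorem wordLength_transpose (he : 0 < e) (hn : 2 ≤ n) (g : Geen e n) :
    wordLength (corranPicantinGens e n) (geenTranspose g) =
      wordLength (corranPicantinGens e n) g := by
  refine wordLength_antiautomorphism geenTranspose_mul geenTranspose_transpose (fun g hg => ?_) g
  obtain ⟨p, q, z, h⟩ := (mem_corranPicantinGens_iff he hn).1 hg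
  exact (mem_corranPicantinGens_iff he hn).2 ⟨p, q, _, h.transpose⟩

theorem IsRowSwap.wordLength_eq (he : 0 < e) (hn : 2 ≤ n) {g : Geen e n} {p q : Fin n} {z : ℂ}
    (h : IsRowSwap g p q z) : wordLength (corranPicantinGens e n) g = 1 := by
  rw [wordLength_eq_geenLength he hn]
  have hnd : ¬IsDescent (1 : Geen e n) p q z := by
    rintro (⟨h1, -⟩ | ⟨-, h1⟩)
    · rw [geenPerm_one] at h1
      exact h1.not_gt h.lt
    · exact h1 (geenVal_one q)
  have := h.geenLength_of_not_isDescent hnd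
  rwa [mul_one, geenLength_one] at this

theorem IsRowSwap.lengthDvd_iff (he : 0 < e) (hn : 2 ≤ n) {g : Geen e n} {p q : Fin n} {z : ℂ}
    (h : IsRowSwap g p q z) (x : Geen e n) :
    LengthDvd (corranPicantinGens e n) g x ↔ IsDescent x p q z := by
  rw [_root_.lengthDvd_iff, h.wordLength_eq he hn, h.inv_eq, wordLength_eq_geenLength he hn,
    wordLength_eq_geenLength he hn]
  by_cases hd : IsDescent x p q z
  · have := h.geenLength_of_isDescent hd
    exact ⟨fun _ => hd, fun _ => by omega⟩
  · have := h.geenLength_of_not_isDescent hd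
    exact ⟨fun _ => by omega, fun h => absurd h hd⟩

/-- Since `u⁻¹ * v` divides `u⁻¹ * λ ^ k`, it suffices that the latter divides `λ ^ k`. Its
complement is the conjugate of `u` by `λ ^ k`, which has the length of `u`. -/
theorem quotient_mem_lam_interval (he : 0 < e) (hn : 2 ≤ n) (k : ℕ) (u v : Geen e n)
    (huv : LengthDvd (corranPicantinGens e n) u v)
    (hv : v ∈ lengthInterval (corranPicantinGens e n) (lam e n ^ k)) :
    u⁻¹ * v ∈ lengthInterval (corranPicantinGens e n) (lam e n ^ k) := by
  have hsub := wordLength_mul_le he hn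
  rw [mem_lengthInterval] at *
  refine (huv.quotient hsub hv).trans hsub ?_
  have hu := huv.trans hsub hv
  rw [lengthDvd_iff] at hu ⊢
  have h1 := geenLength_lam_pow_mul k ((lam e n ^ k)⁻¹ * u)
  have e1 : (u⁻¹ * lam e n ^ k)⁻¹ * lam e n ^ k = (lam e n ^ k)⁻¹ * u * lam e n ^ k := by group
  rw [mul_inv_cancel_left, ← wordLength_eq_geenLength he hn,
    ← wordLength_eq_geenLength he hn] at h1
  rw [e1]
  omega

theorem geenVal_of_mem_interval (hn : 2 ≤ n) (hk : 1 ≤ k) (hke : k ≤ e - 1) {x : Geen e n}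
    (hx : x ∈ lengthInterval (corranPicantinGens e n) (lam e n ^ k)) {j i : Fin n}
    (hji : j < i) (hp : geenPerm x j < geenPerm x i) (hi : geenVal x i ≠ 1) :
    geenVal x i = zetaRoot e ^ k := by
  have he : 0 < e := by omega
  refine geenVal_of_geenLength_add hk hke ?_ hji hp hi
  have h := lengthDvd_iff.1 (mem_lengthInterval.1 hx)
  rw [← wordLength_inv he hn (x⁻¹ * _), mul_inv_rev, inv_inv] at h
  simpa only [wordLength_eq_geenLength he hn] using h

/-! ### Joins of generators -/

/-- A common multiple `j = s * u = t * v` of two generators is their join in `[1, λ ^ k]` as soon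
as dividing by it shortens their common multiples by the length of the words involved. -/
theorem isJoin_of_geenLength_le (hn : 2 ≤ n) (hk : 1 ≤ k) (hke : k ≤ e - 1)
    {s t u v : Geen e n} {p q p' q' : Fin n} {z z' : ℂ} (hs : IsRowSwap s p q z)
    (ht : IsRowSwap t p' q' z') {m : ℕ} (huv : s * u = t * v)
    (hu : wordLength (corranPicantinGens e n) u ≤ m)
    (hv : wordLength (corranPicantinGens e n) v ≤ m)
    (h : ∀ x ∈ lengthInterval (corranPicantinGens e n) (lam e n ^ k), IsDescent x p q z →
      IsDescent x p' q' z' → geenLength (u⁻¹ * (s * x)) + (m + 1) ≤ geenLength x) :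
    ∃ j, LengthDvd (corranPicantinGens e n) s j ∧ LengthDvd (corranPicantinGens e n) t j ∧
      ∀ x ∈ lengthInterval (corranPicantinGens e n) (lam e n ^ k),
        LengthDvd (corranPicantinGens e n) s x → LengthDvd (corranPicantinGens e n) t x →
          LengthDvd (corranPicantinGens e n) j x := by
  have he : 0 < e := by omega
  have hsub := wordLength_mul_le he hn
  have hls := hs.wordLength_eq he hn
  have hlt := ht.wordLength_eq he hn
  have hinv : ∀ x, (s * u)⁻¹ * x = u⁻¹ * (s * x) := by
    intro x
    rw [mul_inv_rev, hs.inv_eq, mul_assoc]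
  have h' : ∀ x ∈ lengthInterval (corranPicantinGens e n) (lam e n ^ k), IsDescent x p q z →
      IsDescent x p' q' z' → wordLength (corranPicantinGens e n) ((s * u)⁻¹ * x) + (m + 1) ≤
        wordLength (corranPicantinGens e n) x := by
    intro x hx h1 h2
    rw [hinv, wordLength_eq_geenLength he hn, wordLength_eq_geenLength he hn]
    exact h x hx h1 h2
  -- Testing the hypothesis on `λ ^ k` itself, of which every generator is a descent, shows that `s
  -- * u` has length exactly `m + 1`.
  have h1 := h' _ (self_mem_lengthInterval _ _) (isDescent_lam_pow hk hke hs.succ z)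
    (isDescent_lam_pow hk hke ht.succ z')
  have h2 := hsub (s * u) ((s * u)⁻¹ * lam e n ^ k)
  rw [mul_inv_cancel_left] at h2
  have h3 := hsub s u
  have h4 := hsub t v
  rw [← huv] at h4
  refine ⟨s * u, ⟨u, rfl, by omega⟩, ⟨v, huv, by omega⟩, fun x hx hsx htx => ?_⟩
  have h5 := h' x hx ((hs.lengthDvd_iff he hn x).1 hsx) ((ht.lengthDvd_iff he hn x).1 htx)
  have h6 := hsub (s * u) ((s * u)⁻¹ * x)
  rw [mul_inv_cancel_left] at h6
  rw [lengthDvd_iff]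
  omega

theorem exists_join_commuting (hn : 2 ≤ n) (hk : 1 ≤ k) (hke : k ≤ e - 1) {s t : Geen e n}
    {p q p' q' : Fin n} {z z' : ℂ} (hs : IsRowSwap s p q z) (ht : IsRowSwap t p' q' z')
    (hlt : q.val < p'.val) :
    ∃ j, LengthDvd (corranPicantinGens e n) s j ∧ LengthDvd (corranPicantinGens e n) t j ∧
      ∀ x ∈ lengthInterval (corranPicantinGens e n) (lam e n ^ k),
        LengthDvd (corranPicantinGens e n) s x → LengthDvd (corranPicantinGens e n) t x →
          LengthDvd (corranPicantinGens e n) j x := by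
  have he : 0 < e := by omega
  have h1 := hs.succ
  have h2 := ht.succ
  have a1 : p ≠ p' := fun h => by rw [h] at h1; omega
  have a2 : p ≠ q' := fun h => by rw [h] at h1; omega
  have a3 : q ≠ p' := fun h => by rw [h] at hlt; omega
  have a4 : q ≠ q' := fun h => by rw [h] at hlt; omega
  refine isJoin_of_geenLength_le hn hk hke hs ht (u := t) (v := s) (m := 1) ?_
    (ht.wordLength_eq he hn).le (hs.wordLength_eq he hn).le ?_
  · refine geen_ext (fun i => ?_) fun i => ?_
    · simp only [hs.perm_mul, ht.perm_mul, hs.perm, ht.perm, Equiv.swap_apply_def]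
      split_ifs <;> simp_all
    · simp only [hs.val_mul, ht.val_mul, hs.val, ht.val, rowSwapVal]
      split_ifs <;> simp_all
  · intro x _ hx hx'
    rw [ht.inv_eq]
    have e1 := hs.geenLength_of_isDescent hx
    -- Multiplying by `s` leaves the rows `p'` and `q'` untouched.
    have hd : IsDescent (s * x) p' q' z' := by
      unfold IsDescent at hx' ⊢
      simpa only [hs.perm_mul, hs.val_mul, a1.symm, a2.symm, a3.symm, a4.symm, if_false] using hx'
    have e2 := ht.geenLength_of_isDescent hd
    omega

theorem exists_join_braid (hn : 2 ≤ n) (hk : 1 ≤ k) (hke : k ≤ e - 1) {s t : Geen e n}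
    {p q r : Fin n} {z z' : ℂ} (hs : IsRowSwap s p q z) (ht : IsRowSwap t q r z') :
    ∃ j, LengthDvd (corranPicantinGens e n) s j ∧ LengthDvd (corranPicantinGens e n) t j ∧
      ∀ x ∈ lengthInterval (corranPicantinGens e n) (lam e n ^ k),
        LengthDvd (corranPicantinGens e n) s x → LengthDvd (corranPicantinGens e n) t x →
          LengthDvd (corranPicantinGens e n) j x := by
  have he : 0 < e := by omega
  have h1 := hs.succ
  have h2 := ht.succ
  obtain rfl := ht.scalar (by omega)
  have hz := hs.scalar_ne_zero
  have a1 : p ≠ q := hs.ne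
  have a2 : q ≠ r := ht.ne
  have a3 : p ≠ r := (hs.lt.trans ht.lt).ne
  refine isJoin_of_geenLength_le hn hk hke hs ht (u := t * s) (v := s * t) (m := 2) ?_ ?_ ?_ ?_
  · refine geen_ext (fun i => ?_) fun i => ?_
    · simp only [hs.perm_mul, ht.perm_mul, hs.perm, ht.perm, Equiv.swap_apply_def]
      split_ifs <;> simp_all
    · simp only [hs.val_mul, ht.val_mul, hs.val, ht.val, rowSwapVal]
      split_ifs <;> simp_all
  · have := wordLength_mul_le he hn t s
    rwa [hs.wordLength_eq he hn, ht.wordLength_eq he hn] at this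
  · have := wordLength_mul_le he hn s t
    rwa [hs.wordLength_eq he hn, ht.wordLength_eq he hn] at this
  · intro x _ hx hx'
    rw [mul_inv_rev, hs.inv_eq, ht.inv_eq, mul_assoc]
    have e1 := hs.geenLength_of_isDescent hx
    have hd : IsDescent (s * x) q r 1 := by
      unfold IsDescent at hx hx' ⊢
      simp only [hs.perm_mul, hs.val_mul, a1.symm, a2.symm, a3.symm, if_false, if_true,
        one_mul] at hx hx' ⊢
      have hpr := (geenPerm x).injective.ne a3
      rcases hx with ⟨h3, h4⟩ | ⟨h3, h4⟩ <;> rcases hx' with ⟨h5, h6⟩ | ⟨h5, h6⟩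
      · exact Or.inl ⟨h5.trans h3, h4⟩
      · rcases lt_or_gt_of_ne hpr with h7 | h7
        · exact Or.inr ⟨h7, h6⟩
        · exact Or.inl ⟨h7, h4⟩
      · exact absurd h6 h4
      · exact Or.inr ⟨h3.trans h5, h6⟩
    have e2 := ht.geenLength_of_isDescent hd
    -- Rows `p` and `q` now hold the original rows `q` (scaled by `z⁻¹`) and `r`, so this is the
    -- descent of `x` at `q`, `r`.
    have hd' : IsDescent (t * (s * x)) p q z := by
      unfold IsDescent at hx' ⊢
      simpa [ht.perm_mul, ht.val_mul, hs.perm_mul, hs.val_mul, a1, a2, a3, a1.symm, a2.symm,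
        a3.symm, hz] using hx'
    have e3 := hs.geenLength_of_isDescent hd'
    omega

theorem exists_join_same_rows (hn : 2 ≤ n) (hk : 1 ≤ k) (hke : k ≤ e - 1) {s t : Geen e n}
    {p q : Fin n} {z z' : ℂ} (hs : IsRowSwap s p q z) (ht : IsRowSwap t p q z') :
    ∃ j, LengthDvd (corranPicantinGens e n) s j ∧ LengthDvd (corranPicantinGens e n) t j ∧
      ∀ x ∈ lengthInterval (corranPicantinGens e n) (lam e n ^ k),
        LengthDvd (corranPicantinGens e n) s x → LengthDvd (corranPicantinGens e n) t x →
          LengthDvd (corranPicantinGens e n) j x := by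
  have he : 0 < e := by omega
  by_cases hzz : z = z'
  · subst hzz
    obtain rfl := hs.unique ht
    exact ⟨s, lengthDvd_refl s, lengthDvd_refl s, fun x _ h _ => h⟩
  have hp : p.val = 0 := by
    by_contra hp
    exact hzz ((hs.scalar hp).trans (ht.scalar hp).symm)
  have hz := hs.scalar_ne_zero
  have hz' := ht.scalar_ne_zero
  have hζ : zetaRoot e ^ k ≠ 0 := pow_ne_zero _ (zetaRoot_ne_zero e)
  have hζe : (zetaRoot e ^ k) ^ e = 1 := by
    rw [← pow_mul, mul_comm, pow_mul, zetaRoot_pow, one_pow]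
  have a1 : p ≠ q := hs.ne
  -- With this scalar, `s * u` is diagonal with first two entries `ζ_e ^ (-k)` and `ζ_e ^ k`,
  -- independently of `z`.
  obtain ⟨u, hu⟩ := exists_isRowSwap (e := e) (z := z * (zetaRoot e ^ k)⁻¹) hs.succ
    (by rw [mul_pow, inv_pow, hζe, hs.pow_eq, inv_one, one_mul]) (fun h => absurd hp h) he
  obtain ⟨v, hv⟩ := exists_isRowSwap (e := e) (z := z' * (zetaRoot e ^ k)⁻¹) hs.succ
    (by rw [mul_pow, inv_pow, hζe, ht.pow_eq, inv_one, one_mul]) (fun h => absurd hp h) he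
  refine isJoin_of_geenLength_le hn hk hke hs ht (u := u) (v := v) (m := 1) ?_
    (hu.wordLength_eq he hn).le (hv.wordLength_eq he hn).le ?_
  · refine geen_ext (fun i => ?_) fun i => ?_
    · rw [geenPerm_mul, geenPerm_mul, hs.perm, ht.perm, hu.perm, hv.perm]
    · rw [hs.val_mul, ht.val_mul, hu.val, hv.val]
      simp only [rowSwapVal, a1.symm, if_true, if_false]
      split_ifs
      · field_simp
      · field_simp
      · rfl
  · intro x hx hxs hxt
    rw [hu.inv_eq]
    have e1 := hs.geenLength_of_isDescent hxs
    have hd : IsDescent (s * x) p q (z * (zetaRoot e ^ k)⁻¹) := by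
      -- An inverted pair is a descent for one scalar only, so with `z ≠ z'` the pair is not
      -- inverted and the entry of row `q` is `ζ_e ^ k`.
      rcases hxs with ⟨h1, h2⟩ | ⟨h1, h2⟩
      · rcases hxt with ⟨-, h3⟩ | ⟨h3, -⟩
        · exact absurd (mul_right_cancel₀ (geenVal_ne_zero x p) (h2.trans h3.symm)) hzz
        · exact absurd h1 h3.not_gt
      · have h3 := geenVal_of_mem_interval hn hk hke hx hs.lt h1 h2
        refine Or.inl ?_
        simp only [hs.perm_mul, hs.val_mul, a1.symm, if_true, if_false, h3]
        exact ⟨h1, by field_simp⟩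
    have e2 := hu.geenLength_of_isDescent hd
    omega

theorem exists_join_generators (hn : 2 ≤ n) (hk : 1 ≤ k) (hke : k ≤ e - 1) (s : Geen e n)
    (hs : s ∈ corranPicantinGens e n) (t : Geen e n) (ht : t ∈ corranPicantinGens e n) :
    ∃ j, LengthDvd (corranPicantinGens e n) s j ∧ LengthDvd (corranPicantinGens e n) t j ∧
      ∀ x ∈ lengthInterval (corranPicantinGens e n) (lam e n ^ k),
        LengthDvd (corranPicantinGens e n) s x → LengthDvd (corranPicantinGens e n) t x →
          LengthDvd (corranPicantinGens e n) j x := by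
  have he : 0 < e := by omega
  obtain ⟨p, q, z, hs⟩ := (mem_corranPicantinGens_iff he hn).1 hs
  obtain ⟨p', q', z', ht⟩ := (mem_corranPicantinGens_iff he hn).1 ht
  have h1 := hs.succ
  have h2 := ht.succ
  rcases lt_trichotomy p.val p'.val with h | h | h
  · by_cases hq : q = p'
    · subst hq
      exact exists_join_braid hn hk hke hs ht
    · rw [Fin.ext_iff] at hq
      exact exists_join_commuting hn hk hke hs ht (by omega)
  · obtain rfl : p = p' := Fin.ext h
    obtain rfl : q = q' := Fin.ext (by omega)
    exact exists_join_same_rows hn hk hke hs ht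
  · have key : ∃ j, LengthDvd (corranPicantinGens e n) t j ∧
        LengthDvd (corranPicantinGens e n) s j ∧
        ∀ x ∈ lengthInterval (corranPicantinGens e n) (lam e n ^ k),
          LengthDvd (corranPicantinGens e n) t x → LengthDvd (corranPicantinGens e n) s x →
            LengthDvd (corranPicantinGens e n) j x := by
      by_cases hq : q' = p
      · subst hq
        exact exists_join_braid hn hk hke ht hs
      · rw [Fin.ext_iff] at hq
        exact exists_join_commuting hn hk hke ht hs (by omega)
    obtain ⟨j, htj, hsj, hj⟩ := key
    exact ⟨j, hsj, htj, fun x hx h h' => hj x hx h' h⟩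

/-- The interval `[1, λ ^ k]` has joins. -/
theorem isJoinInterval_lam_pow (hn : 2 ≤ n) (hk : 1 ≤ k) (hke : k ≤ e - 1) :
    IsJoinInterval (corranPicantinGens e n) (lam e n ^ k) := by
  have he : 0 < e := by omega
  refine ⟨wordLength_mul_le he hn, fun g => eq_one_of_wordLength_eq_zero he hn,
    quotient_mem_lam_interval he hn k, exists_join_of_atoms (wordLength_mul_le he hn)
      (quotient_mem_lam_interval he hn k) (fun s hs => ?_) (fun g hg => ?_)
      (exists_join_generators hn hk hke)⟩
  · obtain ⟨p, q, z, h⟩ := (mem_corranPicantinGens_iff he hn).1 hs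
    exact h.wordLength_eq he hn
  · obtain ⟨p, q, z, hpq, hz, hz1, hd⟩ := exists_isDescent hg
    obtain ⟨s, hs⟩ := exists_isRowSwap hpq hz hz1 he
    exact ⟨s, (mem_corranPicantinGens_iff he hn).2 ⟨p, q, z, hs⟩, (hs.lengthDvd_iff he hn g).2 hd⟩

end Lambda

theorem mainTheorem2 (e n k : ℕ) (hn : 2 ≤ n) (hk : 1 ≤ k) (hke : k ≤ e - 1) :
    IsGarsideMonoid (IntervalMonoid (corranPicantinGens e n) (lam e n ^ k))
        (intervalTop (corranPicantinGens e n) (lam e n ^ k)) ∧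
      Function.Injective (intervalCopy (corranPicantinGens e n) (lam e n ^ k)) ∧
      garsideSimples (intervalTop (corranPicantinGens e n) (lam e n ^ k)) =
        Set.range (intervalCopy (corranPicantinGens e n) (lam e n ^ k)) ∧
      ∃ (Γ : Type) (_ : Group Γ)
        (ι : IntervalMonoid (corranPicantinGens e n) (lam e n ^ k) →* Γ),
        IsGroupOfFractions ι := by
  have he : 0 < e := by omega
  have H := isJoinInterval_lam_pow hn hk hke
  have := geen_finite (n := n) he
  have hG := H.isGarsideMonoid (Set.toFinite _) geenTranspose_mul geenTranspose_transpose
    (wordLength_transpose he hn) (geenTranspose_lam_pow k)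
  exact ⟨hG, intervalCopy_injective _ _, Set.ext H.dvd_intervalTop_iff,
    hG.exists_isGroupOfFractions⟩
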